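/- Let $T>0$ and $\tau\le -\tfrac12$. For a function $U$ of class $C^k$ on $[0,1]\times[0,T]$ (with any fixed $k\ge 4$, $k=\infty$ or real-analytic allowed) that satisfies $U_t+U_x=0$ there, and for $n\ge 4$, let $h=\frac1{n-1}$, $x_j=(j-1)h$ for $1\le j\le n$, and let $\mathbf u=(u_1,\dots,u_n)^\top:[0,T]\to\mathbb R^n$ be the solution of the semidiscretization $$\mathbf u_t+D_m\mathbf u=\tau H^{-1}\mathbf e_0\,\bigl(u_1-U(0,t)\bigr),\qquad u_j(0)=U(x_j,0),$$ where $\mathbf e_0=(1,0,\dots,0)^\top$, $H=h\,\mathrm{diag}\bigl(\tfrac5{12},\tfrac{13}{12},1,\dots,1,\tfrac{13}{12},\tfrac5{12}\bigr)$, and $D_m$ is the upwind SBP operator (the subscript $m$ stands for "minus") with third-order interior stencil and first-order boundary closures, $$(D_m\mathbf u)_i=\tfrac1h\bigl(\tfrac16u_{i-2}-u_{i-1}+\tfrac12u_i+\tfrac13u_{i+1}\bigr),\quad 3\le i\le n-2,$$ $$(D_m\mathbf u)_1=\tfrac1h(-u_1+u_2),\qquad (D_m\mathbf u)_2=\tfrac1h\bigl(-\tfrac9{13}u_1+\tfrac5{13}u_2+\tfrac4{13}u_3\bigr),$$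 $$(D_m\mathbf u)_{n-1}=\tfrac1h\bigl(\tfrac2{13}u_{n-3}-\tfrac{12}{13}u_{n-2}+\tfrac5{13}u_{n-1}+\tfrac5{13}u_n\bigr),\qquad (D_m\mathbf u)_n=\tfrac1h\bigl(\tfrac25u_{n-2}-\tfrac95u_{n-1}+\tfrac75u_n\bigr).$$ Measure the error by $$E_n(U)=\Bigl(\int_0^T h\sum_{j=1}^n|U(x_j,t)-u_j(t)|^2\,dt\Bigr)^{1/2}.$$ Then the convergence rate, that is, the largest exponent $r$ such that for every such $U$ one has $E_n(U)=O(h^r)$ as $n\to\infty$ (with a constant that may depend on $U$, $T$ and $\tau$, but not on $h$), is $\tfrac52$ if $\tau=-1$, and $2$ if $\tau\ne-1$. -/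

import Mathlib

open Set Filter Asymptotics
open scoped Topology

noncomputable section

/-- `U x t` is a solution of class `C^m`, up to the boundary, of the advection equation
`U_t + U_x = 0` on `[0,1] × [0,T]`. -/
structure IsAdvectionSolution (m : WithTop ℕ∞) (T : ℝ) (U : ℝ → ℝ → ℝ) : Prop where
  smooth : ContDiffOn ℝ m (Function.uncurry U) (Icc 0 1 ×ˢ Icc 0 T)
  equation : ∀ x ∈ Icc (0 : ℝ) 1, ∀ t ∈ Icc (0 : ℝ) T,
    derivWithin (fun s => U x s) (Icc 0 T) t + derivWithin (fun y => U y t) (Icc 0 1) x = 0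

/-- Spacing `h = 1 / (n - 1)` of the uniform grid with `n` points on `[0,1]`. -/
def gridSpacing (n : ℕ) : ℝ := 1 / ((n : ℝ) - 1)

/-- Grid points; the index starts at `0`, so that `gridPoint n 0 = 0`. -/
def gridPoint (n : ℕ) (j : Fin n) : ℝ := (j : ℝ) * gridSpacing n

/-- The entries of `h D_m` for `n` grid points, with row and column indices starting at `0`:
the four-point third-order stencil, skewed to the left, in the interior, and first-order
closures in the first two and the last two rows. -/
def upwindCoeff (n i j : ℕ) : ℝ :=
  if i = 0 then
    if j = 0 then -1 else if j = 1 then 1 else 0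
  else if i = 1 then
    if j = 0 then -9 / 13 else if j = 1 then 5 / 13 else if j = 2 then 4 / 13 else 0
  else if i + 1 = n then
    if j + 3 = n then 2 / 5 else if j + 2 = n then -9 / 5 else if j + 1 = n then 7 / 5 else 0
  else if i + 2 = n then
    if j + 4 = n then 2 / 13 else if j + 3 = n then -12 / 13
    else if j + 2 = n then 5 / 13 else if j + 1 = n then 5 / 13 else 0
  else
    if j + 2 = i then 1 / 6 else if j + 1 = i then -1
    else if j = i then 1 / 2 else if j = i + 1 then 1 / 3 else 0

/-- The upwind SBP operator `D_m` (interior order three, boundary order one). -/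
def upwindDm (n : ℕ) : Matrix (Fin n) (Fin n) ℝ :=
  Matrix.of fun i j => (gridSpacing n)⁻¹ * upwindCoeff n i j

/-- The diagonal SBP norm matrix `H = h diag(5/12, 13/12, 1, …, 1, 13/12, 5/12)` of `D_m`. -/
def sbpNorm (n : ℕ) : Matrix (Fin n) (Fin n) ℝ :=
  Matrix.diagonal fun i =>
    gridSpacing n *
      (if (i : ℕ) = 0 ∨ (i : ℕ) + 1 = n then 5 / 12
        else if (i : ℕ) = 1 ∨ (i : ℕ) + 2 = n then 13 / 12 else 1)

/-- The first unit vector. -/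
def firstUnit (n : ℕ) : Fin n → ℝ := fun i => if (i : ℕ) = 0 then 1 else 0

/-- `u` solves, on `[0,T]`, the semidiscretization `u' + D_m u = τ H⁻¹ e₀ (u₁ - g)` of the
advection equation with initial datum `f` and inflow datum `g`. The value `u₁` at the
inflow point is written as the product of the first unit vector with `u`. -/
structure IsSemidiscreteSolution (n : ℕ) (τ T : ℝ) (f g : ℝ → ℝ) (u : ℝ → Fin n → ℝ) :
    Prop where
  initial : ∀ j, u 0 j = f (gridPoint n j)
  equation : ∀ t ∈ Icc (0 : ℝ) T,
    HasDerivWithinAt u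
      (-(upwindDm n).mulVec (u t)
        + (τ * (firstUnit n ⬝ᵥ u t - g t)) • (sbpNorm n)⁻¹.mulVec (firstUnit n))
      (Icc 0 T) t

/-- The discrete `L²` norm of the error in space and time,
`(∫₀ᵀ h ∑ⱼ |U(xⱼ,t) - uⱼ(t)|² dt)^(1/2)`. -/
def spaceTimeError (n : ℕ) (T : ℝ) (U : ℝ → ℝ → ℝ) (u : ℝ → Fin n → ℝ) : ℝ :=
  Real.sqrt (∫ t in (0 : ℝ)..T, gridSpacing n * ∑ j, (U (gridPoint n j) t - u t j) ^ 2)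

/-- The exponent `r` is attained: for every exact solution of class `C^m`, the error of the
semidiscretization with its initial and inflow data is `O(h^r)` as the grid is refined. -/
def ConvergesWithOrder (m : WithTop ℕ∞) (T τ r : ℝ) : Prop :=
  ∀ U : ℝ → ℝ → ℝ, IsAdvectionSolution m T U →
    ∀ u : (n : ℕ) → ℝ → Fin n → ℝ,
      (∀ n, 4 ≤ n → IsSemidiscreteSolution n τ T (fun x => U x 0) (fun t => U 0 t) (u n)) →
        (fun n => spaceTimeError n T U (u n)) =O[atTop] fun n => gridSpacing n ^ r

/-- The convergence rate is the largest exponent `r` such that the error is `O(h^r)` for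
every exact solution of class `C^m`. -/
def IsConvergenceRate (m : WithTop ℕ∞) (T τ q : ℝ) : Prop :=
  IsGreatest {r : ℝ | ConvergesWithOrder m T τ r} q

end

/-! By the characteristics, `U x t = G (x - t)` with a `C⁴` profile `G`. The error `e` then solves
`e' = -h⁻¹ A e + R`, where `A` is `satOp N τ` and `R` is the truncation error. In the two closure
rows at each end `R` is `h` times a fixed number times `G''` at that end, up to `O(h²)`; in the
interior it is `O(h³)`. Summation by parts makes `A` nonnegative in the weighted inner product for
`τ ≤ -1/2`, but the energy estimate applied directly to `R` only yields the rate `3/2`.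

The upper bound comes from removing the leading closure terms first. Let `φ` and `ψ` be steady
layers for which `A φ` and `A ψ` reproduce these terms, up to exponentially small tails at the
opposite end; then `h² (G''(-t) φ + G''(1-t) ψ)` is subtracted from `e`. The characteristic
polynomial of the interior stencil is a multiple of `(r - 1)(2r² + 5r - 1)`, with roots `1`, `κ` and
`-1/(2κ)`. So `ψ` decays away from the outflow with ratio `-2κ`, whereas `φ` is a multiple of `κ^j`
plus a constant, and the inflow rows force this constant to be a multiple of `1 + 1/τ`. Hence `h ∑
φ²` is `O(h)` for `τ = -1` and `O(1)` otherwise. The remaining forcing is controlled by the same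
quantity, and `SolvesForced.energy_le` bounds the squared error by `O(h⁵)` or `O(h⁴)`; see
`integral_error_sq_le`.

Sharpness is tested on `U = (x - t)²`, whose truncation error is constant in time and exactly
proportional to `h`. The first row alone cannot balance its forcing unless the first two errors have
size `h²`, which gives `h⁵` (`pow_five_le_integral`). For `τ ≠ -1` the equation is paired with an
approximate null vector of the adjoint of `A`. It has a jump proportional to `1 + 1/τ` between the
first two nodes, so the inflow truncation errors no longer cancel in the pairing; this drives an
error of size `h²` in the whole domain (`pow_four_le_integral`). -/

noncomputable section

/-! ### The discrete operator: summation by parts and adjoint -/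

/-- The operator `h (D_m - τ H⁻¹ e₀ e₀ᵀ)` on the first `N + 4` terms of a sequence. -/
def satOp (N : ℕ) (τ : ℝ) (v : ℕ → ℝ) : ℕ → ℝ
  | 0 => -(1 + 12 / 5 * τ) * v 0 + v 1
  | 1 => (-9 * v 0 + 5 * v 1 + 4 * v 2) / 13
  | k + 2 =>
    if k < N then v k / 6 - v (k + 1) + v (k + 2) / 2 + v (k + 3) / 3
    else if k = N then (2 * v N - 12 * v (N + 1) + 5 * v (N + 2) + 5 * v (N + 3)) / 13
    else (2 * v (N + 1) - 9 * v (N + 2) + 7 * v (N + 3)) / 5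

/-- The diagonal of `h⁻¹ H` for `N + 4` grid points. -/
def sbpWeight (N : ℕ) : ℕ → ℝ
  | 0 => 5 / 12
  | 1 => 13 / 12
  | k + 2 => if k < N then 1 else if k = N then 13 / 12 else 5 / 12

section SatOp
variable (N : ℕ) (τ : ℝ) (v : ℕ → ℝ)

lemma satOp_zero : satOp N τ v 0 = -(1 + 12 / 5 * τ) * v 0 + v 1 := rfl

lemma satOp_one : satOp N τ v 1 = (-9 * v 0 + 5 * v 1 + 4 * v 2) / 13 := rfl

lemma satOp_interior {k : ℕ} (hk : k < N) :
    satOp N τ v (k + 2) = v k / 6 - v (k + 1) + v (k + 2) / 2 + v (k + 3) / 3 := by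
  simp [satOp, hk]

lemma satOp_penultimate :
    satOp N τ v (N + 2)
      = (2 * v N - 12 * v (N + 1) + 5 * v (N + 2) + 5 * v (N + 3)) / 13 := by
  simp [satOp]

lemma satOp_last :
    satOp N τ v (N + 3) = (2 * v (N + 1) - 9 * v (N + 2) + 7 * v (N + 3)) / 5 := by
  simp [satOp]

lemma sbpWeight_zero : sbpWeight N 0 = 5 / 12 := rfl

lemma sbpWeight_one : sbpWeight N 1 = 13 / 12 := rfl

lemma sbpWeight_interior {k : ℕ} (hk : k < N) : sbpWeight N (k + 2) = 1 := by
  simp [sbpWeight, hk]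

lemma sbpWeight_penultimate : sbpWeight N (N + 2) = 13 / 12 := by simp [sbpWeight]

lemma sbpWeight_last : sbpWeight N (N + 3) = 5 / 12 := by simp [sbpWeight]

lemma sbpWeight_ge (i : ℕ) : 5 / 12 ≤ sbpWeight N i := by
  unfold sbpWeight; split <;> (try split_ifs) <;> norm_num

lemma sbpWeight_le (i : ℕ) : sbpWeight N i ≤ 13 / 12 := by
  unfold sbpWeight; split <;> (try split_ifs) <;> norm_num

lemma sbpWeight_pos (i : ℕ) : 0 < sbpWeight N i := by
  linarith [sbpWeight_ge N i]

lemma satOp_add (u v : ℕ → ℝ) (i : ℕ) :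
    satOp N τ (fun j => u j + v j) i = satOp N τ u i + satOp N τ v i := by
  unfold satOp; split <;> (try split_ifs) <;> ring

lemma satOp_smul (a : ℝ) (i : ℕ) :
    satOp N τ (fun j => a * v j) i = a * satOp N τ v i := by
  unfold satOp; split <;> (try split_ifs) <;> ring

lemma satOp_sub (u v : ℕ → ℝ) (i : ℕ) :
    satOp N τ (fun j => u j - v j) i = satOp N τ u i - satOp N τ v i := by
  unfold satOp; split <;> (try split_ifs) <;> ring

lemma satOp_eq_satOp_zero (i : ℕ) :
    satOp N τ v i = satOp N 0 v i - if i = 0 then 12 / 5 * τ * v 0 else 0 := by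
  unfold satOp
  split
  · simp; ring
  · simp
  · simp

lemma sum_range_add_four (f : ℕ → ℝ) :
    ∑ i ∈ Finset.range (N + 4), f i
      = f 0 + f 1 + ∑ k ∈ Finset.range N, f (k + 2) + f (N + 2) + f (N + 3) := by
  rw [Finset.sum_range_succ, Finset.sum_range_succ, Finset.sum_range_succ', Finset.sum_range_succ']
  ring

/-- Summation by parts: the dissipation of the upwind operator is a sum of squares of
second differences. -/
lemma sum_mul_satOp :
    ∑ i ∈ Finset.range (N + 4), sbpWeight N i * v i * satOp N τ v i
      = -(1 / 2 + τ) * v 0 ^ 2 + v (N + 3) ^ 2 / 2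
        + (∑ k ∈ Finset.range (N + 2), (v k - 2 * v (k + 1) + v (k + 2)) ^ 2) / 12 := by
  rw [sum_range_add_four, sbpWeight_zero, sbpWeight_one, sbpWeight_penultimate, sbpWeight_last,
    satOp_zero, satOp_one, satOp_penultimate, satOp_last]
  -- Each interior product is one twelfth of a squared second difference plus a telescoping
  -- difference. The bracket collects the end terms, which the closure rows later turn into `-(1/2 +
  -- τ) v₀²`, `v²/2` at the last node and the squares.
  have key : ∀ M : ℕ, ∑ k ∈ Finset.range M,
      v (k + 2) * (v k / 6 - v (k + 1) + v (k + 2) / 2 + v (k + 3) / 3)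
      = (∑ k ∈ Finset.range (M + 2), (v k - 2 * v (k + 1) + v (k + 2)) ^ 2) / 12
        + (-v 0 ^ 2 - 5 * v 1 ^ 2 + 4 * v 0 * v 1 - 4 * v 1 * v 2
            + 4 * v (M + 1) * v (M + 2) - 2 * v M * v (M + 2)
            + 8 * v (M + 1) * v (M + 2) - v (M + 2) ^ 2 - v (M + 3) ^ 2
            - 5 * v (M + 2) ^ 2 + v (M + 2) ^ 2 + 4 * v (M + 2) * v (M + 3)
            - 2 * v (M + 1) * v (M + 3)) / 12 := by
    intro M
    induction M with
    | zero => simp [Finset.sum_range_succ]; ring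
    | succ M ih =>
      rw [Finset.sum_range_succ, ih, Finset.sum_range_succ _ (M + 2)]
      ring
  have : ∑ k ∈ Finset.range N, sbpWeight N (k + 2) * v (k + 2) * satOp N τ v (k + 2)
      = ∑ k ∈ Finset.range N,
          v (k + 2) * (v k / 6 - v (k + 1) + v (k + 2) / 2 + v (k + 3) / 3) := by
    refine Finset.sum_congr rfl fun k hk => ?_
    rw [Finset.mem_range] at hk
    rw [sbpWeight_interior N hk, satOp_interior N τ v hk, one_mul]
  rw [this, key]
  ring

lemma sum_mul_satOp_nonneg (hτ : τ ≤ -1 / 2) :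
    0 ≤ ∑ i ∈ Finset.range (N + 4), sbpWeight N i * v i * satOp N τ v i := by
  rw [sum_mul_satOp]
  have h1 : 0 ≤ -(1 / 2 + τ) * v 0 ^ 2 := mul_nonneg (by linarith) (sq_nonneg _)
  have h2 : 0 ≤ ∑ k ∈ Finset.range (N + 2), (v k - 2 * v (k + 1) + v (k + 2)) ^ 2 :=
    Finset.sum_nonneg fun _ _ => sq_nonneg _
  positivity

/-- The adjoint of `satOp` with respect to the quadrature weights. -/
lemma sum_mul_satOp_eq_adjoint (y : ℕ → ℝ) :
    ∑ i ∈ Finset.range (N + 4), sbpWeight N i * y i * satOp N τ v i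
      = v 0 * ((-(5 + 12 * τ) * y 0 - 9 * y 1 + 2 * y 2) / 12)
        + v 1 * ((5 * y 0 + 5 * y 1 - 12 * y 2 + 2 * y 3) / 12)
        + ∑ k ∈ Finset.range N,
            v (k + 2) * (y (k + 1) / 3 + y (k + 2) / 2 - y (k + 3) + y (k + 4) / 6)
        + v (N + 2) * ((4 * y (N + 1) + 5 * y (N + 2) - 9 * y (N + 3)) / 12)
        + v (N + 3) * ((5 * y (N + 2) + 7 * y (N + 3)) / 12) := by
  rw [sum_range_add_four, sbpWeight_zero, sbpWeight_one, sbpWeight_penultimate, sbpWeight_last,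
    satOp_zero, satOp_one, satOp_penultimate, satOp_last]
  have key : ∀ M : ℕ, ∑ k ∈ Finset.range M,
      y (k + 2) * (v k / 6 - v (k + 1) + v (k + 2) / 2 + v (k + 3) / 3)
      = ∑ k ∈ Finset.range M,
            v (k + 2) * (y (k + 1) / 3 + y (k + 2) / 2 - y (k + 3) + y (k + 4) / 6)
        + (v 0 * y 2 / 6 + v 1 * (-y 2 + y 3 / 6) - v 2 * y 1 / 3
          - v M * y (M + 2) / 6 - v (M + 1) * (-y (M + 2) + y (M + 3) / 6)
          + v (M + 2) * y (M + 1) / 3) := by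
    intro M
    induction M with
    | zero => simp; ring
    | succ M ih =>
      rw [Finset.sum_range_succ, ih, Finset.sum_range_succ _ M]
      ring
  have : ∑ k ∈ Finset.range N, sbpWeight N (k + 2) * y (k + 2) * satOp N τ v (k + 2)
      = ∑ k ∈ Finset.range N,
          y (k + 2) * (v k / 6 - v (k + 1) + v (k + 2) / 2 + v (k + 3) / 3) := by
    refine Finset.sum_congr rfl fun k hk => ?_
    rw [Finset.mem_range] at hk
    rw [sbpWeight_interior N hk, satOp_interior N τ v hk, one_mul]
  rw [this, key]
  ring

end SatOp

/-! ### From matrices on `Fin (N + 4)` to sequences -/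

/-- The extension by zero of a vector to a sequence. -/
def extendZero {n : ℕ} (u : Fin n → ℝ) (j : ℕ) : ℝ := if hj : j < n then u ⟨j, hj⟩ else 0

lemma extendZero_val {n : ℕ} (u : Fin n → ℝ) (i : Fin n) : extendZero u i = u i := by
  simp [extendZero]

lemma sum_extendZero {n : ℕ} (u : Fin n → ℝ) (c : ℕ → ℝ) :
    ∑ j : Fin n, c j * u j = ∑ j ∈ Finset.range n, c j * extendZero u j := by
  rw [← Fin.sum_univ_eq_sum_range (fun j => c j * extendZero u j)]
  simp [extendZero_val]

lemma sum_range_ite_eq_mul {n a : ℕ} (ha : a < n) (c : ℝ) (v : ℕ → ℝ) :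
    ∑ j ∈ Finset.range n, (if j = a then c else 0) * v j = c * v a := by
  simp [ite_mul, ha]

lemma sum_upwindCoeff_mul (N : ℕ) (v : ℕ → ℝ) {i : ℕ} (hi : i < N + 4) :
    ∑ j ∈ Finset.range (N + 4), upwindCoeff (N + 4) i j * v j = satOp N 0 v i := by
  -- Each row of nested conditionals is replaced by a sum of single-column indicators, which
  -- `sum_range_ite_eq_mul` evaluates term by term.
  have expand : ∀ (s : ℕ → ℝ) (t : ℝ), (∀ j < N + 4, upwindCoeff (N + 4) i j = s j) →
      ∑ j ∈ Finset.range (N + 4), s j * v j = t →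
      ∑ j ∈ Finset.range (N + 4), upwindCoeff (N + 4) i j * v j = t := by
    intro s t hs ht
    rw [← ht]
    exact Finset.sum_congr rfl fun j hj => by rw [hs j (Finset.mem_range.1 hj)]
  rcases i with _ | _ | k
  · refine expand (fun j => (if j = 0 then (-1 : ℝ) else 0) + (if j = 1 then 1 else 0)) _ ?_ ?_
    · intro j _
      rw [upwindCoeff, if_pos rfl]
      split_ifs <;> first | omega | norm_num
    · simp only [add_mul, Finset.sum_add_distrib]
      rw [sum_range_ite_eq_mul (by omega), sum_range_ite_eq_mul (by omega), satOp_zero]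
      ring
  · refine expand (fun j => (if j = 0 then (-9 / 13 : ℝ) else 0) + (if j = 1 then 5 / 13 else 0)
      + (if j = 2 then 4 / 13 else 0)) _ ?_ ?_
    · intro j _
      rw [upwindCoeff, if_neg (by omega), if_pos rfl]
      split_ifs <;> first | omega | norm_num
    · simp only [add_mul, Finset.sum_add_distrib]
      rw [sum_range_ite_eq_mul (by omega), sum_range_ite_eq_mul (by omega),
        sum_range_ite_eq_mul (by omega), satOp_one]
      ring
  · rcases lt_trichotomy k N with hk | rfl | hk
    · refine expand (fun j => (if j = k then (1 / 6 : ℝ) else 0) + (if j = k + 1 then -1 else 0)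
        + (if j = k + 2 then 1 / 2 else 0) + (if j = k + 3 then 1 / 3 else 0)) _ ?_ ?_
      · intro j _
        rw [upwindCoeff, if_neg (by omega), if_neg (by omega), if_neg (by omega),
          if_neg (by omega)]
        simp only [show j + 2 = k + 1 + 1 ↔ j = k by omega,
          show j + 1 = k + 1 + 1 ↔ j = k + 1 by omega]
        split_ifs <;> first | omega | norm_num
      · simp only [add_mul, Finset.sum_add_distrib]
        rw [sum_range_ite_eq_mul (by omega), sum_range_ite_eq_mul (by omega),
          sum_range_ite_eq_mul (by omega), sum_range_ite_eq_mul (by omega),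
          satOp_interior _ _ _ hk]
        ring
    · refine expand (fun j => (if j = k then (2 / 13 : ℝ) else 0)
        + (if j = k + 1 then -12 / 13 else 0)
        + (if j = k + 2 then 5 / 13 else 0) + (if j = k + 3 then 5 / 13 else 0)) _ ?_ ?_
      · intro j _
        rw [upwindCoeff, if_neg (by omega), if_neg (by omega), if_neg (by omega),
          if_pos (by omega)]
        simp only [show j + 4 = k + 4 ↔ j = k by omega, show j + 3 = k + 4 ↔ j = k + 1 by omega,
          show j + 2 = k + 4 ↔ j = k + 2 by omega, show j + 1 = k + 4 ↔ j = k + 3 by omega]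
        split_ifs <;> first | omega | norm_num
      · simp only [add_mul, Finset.sum_add_distrib]
        rw [sum_range_ite_eq_mul (by omega), sum_range_ite_eq_mul (by omega),
          sum_range_ite_eq_mul (by omega), sum_range_ite_eq_mul (by omega), satOp_penultimate]
        ring
    · obtain rfl : k = N + 1 := by omega
      refine expand (fun j => (if j = N + 1 then (2 / 5 : ℝ) else 0)
        + (if j = N + 2 then -9 / 5 else 0) + (if j = N + 3 then 7 / 5 else 0)) _ ?_ ?_
      · intro j _
        rw [upwindCoeff, if_neg (by omega), if_neg (by omega), if_pos (by omega)]
        simp only [show j + 3 = N + 4 ↔ j = N + 1 by omega,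
          show j + 2 = N + 4 ↔ j = N + 2 by omega, show j + 1 = N + 4 ↔ j = N + 3 by omega]
        split_ifs <;> first | omega | norm_num
      · simp only [add_mul, Finset.sum_add_distrib]
        rw [sum_range_ite_eq_mul (by omega), sum_range_ite_eq_mul (by omega),
          sum_range_ite_eq_mul (by omega), satOp_last]
        ring

lemma gridSpacing_add_four (N : ℕ) : gridSpacing (N + 4) = 1 / (N + 3) := by
  unfold gridSpacing; push_cast; congr 1; ring

lemma gridSpacing_add_four_pos (N : ℕ) : 0 < gridSpacing (N + 4) := by
  rw [gridSpacing_add_four]; positivity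

lemma upwindDm_mulVec (N : ℕ) (u : Fin (N + 4) → ℝ) (i : Fin (N + 4)) :
    (upwindDm (N + 4)).mulVec u i
      = (gridSpacing (N + 4))⁻¹ * satOp N 0 (extendZero u) i := by
  rw [← sum_upwindCoeff_mul N _ i.2, ← sum_extendZero u (fun j => upwindCoeff (N + 4) i j),
    Finset.mul_sum]
  simp [Matrix.mulVec, dotProduct, upwindDm, mul_assoc]

lemma sbpNorm_inv_mulVec_firstUnit (N : ℕ) (i : Fin (N + 4)) :
    (sbpNorm (N + 4))⁻¹.mulVec (firstUnit (N + 4)) i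
      = if (i : ℕ) = 0 then 12 / 5 * (gridSpacing (N + 4))⁻¹ else 0 := by
  have hpos := gridSpacing_add_four_pos N
  set d : Fin (N + 4) → ℝ := fun i => gridSpacing (N + 4) *
      (if (i : ℕ) = 0 ∨ (i : ℕ) + 1 = N + 4 then 5 / 12
        else if (i : ℕ) = 1 ∨ (i : ℕ) + 2 = N + 4 then 13 / 12 else 1) with hd
  have hne : ∀ i, d i ≠ 0 := fun i => by
    simp only [hd]
    refine mul_ne_zero hpos.ne' ?_
    split_ifs <;> norm_num
  have hinv : (sbpNorm (N + 4))⁻¹ = Matrix.diagonal fun i => (d i)⁻¹ := by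
    refine Matrix.inv_eq_right_inv ?_
    unfold sbpNorm
    rw [Matrix.diagonal_mul_diagonal, ← Matrix.diagonal_one]
    congr 1
    funext i
    exact mul_inv_cancel₀ (hne i)
  rw [hinv, Matrix.mulVec_diagonal]
  by_cases hi : (i : ℕ) = 0
  · simp only [hd, firstUnit, hi, true_or, if_true]
    field_simp
  · simp [firstUnit, hi]

lemma firstUnit_dotProduct (N : ℕ) (u : Fin (N + 4) → ℝ) :
    firstUnit (N + 4) ⬝ᵥ u = extendZero u 0 := by
  have : extendZero u 0 = u 0 := by simp [extendZero]
  rw [this, dotProduct, Finset.sum_eq_single (0 : Fin (N + 4))]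
  · simp [firstUnit]
  · intro b _ hb
    have : (b : ℕ) ≠ 0 := fun h => hb (Fin.ext h)
    simp [firstUnit, this]
  · simp

/-! ### The error equation and the energy estimate -/

/-- The sequences `e t` solve the semidiscrete equation with homogeneous inflow datum and
forcing `R` on `[0,T]`. -/
def SolvesForced (N : ℕ) (τ T : ℝ) (e R : ℝ → ℕ → ℝ) : Prop :=
  ∀ i < N + 4, ∀ t ∈ Icc (0 : ℝ) T,
    HasDerivWithinAt (fun s => e s i)
      (-(gridSpacing (N + 4))⁻¹ * satOp N τ (e t) i + R t i) (Icc 0 T) t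

/-- The penalty splits: its part in the unknown is absorbed into row 0 of `satOp N τ`, and its part
in the datum `g` remains as forcing. The factor `12/5` is the inverse of the first weight `5/12`. -/
lemma IsSemidiscreteSolution.hasDerivWithinAt {N : ℕ} {τ T : ℝ} {f g : ℝ → ℝ}
    {u : ℝ → Fin (N + 4) → ℝ} (hu : IsSemidiscreteSolution (N + 4) τ T f g u)
    {i : ℕ} (hi : i < N + 4) {t : ℝ} (ht : t ∈ Icc (0 : ℝ) T) :
    HasDerivWithinAt (fun s => extendZero (u s) i)
      (-(gridSpacing (N + 4))⁻¹ * satOp N τ (extendZero (u t)) i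
        - if i = 0 then 12 / 5 * τ * (gridSpacing (N + 4))⁻¹ * g t else 0) (Icc 0 T) t := by
  have h := (hasDerivWithinAt_pi.1 (hu.equation t ht)) ⟨i, hi⟩
  have e1 : (fun s => extendZero (u s) i) = fun s => u s ⟨i, hi⟩ := by
    funext s; simp [extendZero, hi]
  rw [e1]
  refine h.congr_deriv ?_
  rw [Pi.add_apply, Pi.neg_apply, Pi.smul_apply, upwindDm_mulVec, sbpNorm_inv_mulVec_firstUnit,
    firstUnit_dotProduct, satOp_eq_satOp_zero N τ]
  by_cases h0 : i = 0
  · subst h0; simp; ring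
  · simp [h0]

/-- The error of the semidiscretization solves the forced equation, with the truncation error
as forcing. -/
lemma IsSemidiscreteSolution.solvesForced {N : ℕ} {τ T : ℝ} {f g : ℝ → ℝ}
    {u : ℝ → Fin (N + 4) → ℝ} (hu : IsSemidiscreteSolution (N + 4) τ T f g u)
    {p q : ℝ → ℕ → ℝ} (hg : ∀ t ∈ Icc (0 : ℝ) T, p t 0 = g t)
    (hp : ∀ i < N + 4, ∀ t ∈ Icc (0 : ℝ) T,
      HasDerivWithinAt (fun s => p s i) (-q t i) (Icc 0 T) t) :
    SolvesForced N τ T (fun t i => p t i - extendZero (u t) i)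
      (fun t i => (gridSpacing (N + 4))⁻¹ * satOp N 0 (p t) i - q t i) := by
  intro i hi t ht
  refine ((hp i hi t ht).sub (hu.hasDerivWithinAt hi ht)).congr_deriv ?_
  -- Since `p` matches the datum at the inflow node, the penalty on `p` cancels the `g` term, and
  -- the forcing involves only the operator with `τ = 0`.
  rw [satOp_sub, satOp_eq_satOp_zero N τ (p t)]
  by_cases h0 : i = 0
  · subst h0; simp [hg t ht]; ring
  · simp [h0]; ring

lemma SolvesForced.continuousOn {N : ℕ} {τ T : ℝ} {e R : ℝ → ℕ → ℝ}
    (he : SolvesForced N τ T e R) {i : ℕ} (hi : i < N + 4) :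
    ContinuousOn (fun t => e t i) (Icc 0 T) := fun t ht => (he i hi t ht).continuousWithinAt

/-- The energy estimate. -/
lemma SolvesForced.energy_le {N : ℕ} {τ T : ℝ} (hτ : τ ≤ -1 / 2) {e R : ℝ → ℕ → ℝ}
    (he : SolvesForced N τ T e R) {M : ℝ} (hM : 0 ≤ M)
    (hR : ∀ t ∈ Icc (0 : ℝ) T, ∑ i ∈ Finset.range (N + 4), sbpWeight N i * R t i ^ 2 ≤ M)
    {t : ℝ} (ht : t ∈ Icc (0 : ℝ) T) :
    ∑ i ∈ Finset.range (N + 4), sbpWeight N i * e t i ^ 2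
      ≤ Real.exp T * (∑ i ∈ Finset.range (N + 4), sbpWeight N i * e 0 i ^ 2 + M) := by
  set f : ℝ → ℝ := fun t => ∑ i ∈ Finset.range (N + 4), sbpWeight N i * e t i ^ 2 with hf
  set f' : ℝ → ℝ := fun t => ∑ i ∈ Finset.range (N + 4), sbpWeight N i *
    (2 * e t i * (-(gridSpacing (N + 4))⁻¹ * satOp N τ (e t) i + R t i)) with hf'
  have hder : ∀ t ∈ Icc (0 : ℝ) T, HasDerivWithinAt f (f' t) (Icc 0 T) t := by
    intro t ht
    refine HasDerivWithinAt.fun_sum fun i hi => ?_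
    have := ((he i (Finset.mem_range.1 hi) t ht).pow 2).const_mul (sbpWeight N i)
    refine this.congr_deriv ?_
    push_cast; ring
  have hle : ∀ t ∈ Icc (0 : ℝ) T, f' t ≤ f t + M := by
    intro t ht
    have h1 : f' t = -2 * (gridSpacing (N + 4))⁻¹ *
        (∑ i ∈ Finset.range (N + 4), sbpWeight N i * e t i * satOp N τ (e t) i)
        + ∑ i ∈ Finset.range (N + 4), sbpWeight N i * (2 * e t i * R t i) := by
      rw [hf', Finset.mul_sum, ← Finset.sum_add_distrib]
      exact Finset.sum_congr rfl fun i _ => by ring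
    have h2 : ∑ i ∈ Finset.range (N + 4), sbpWeight N i * (2 * e t i * R t i)
        ≤ f t + ∑ i ∈ Finset.range (N + 4), sbpWeight N i * R t i ^ 2 := by
      rw [hf, ← Finset.sum_add_distrib]
      refine Finset.sum_le_sum fun i _ => ?_
      have := mul_le_mul_of_nonneg_left (two_mul_le_add_sq (e t i) (R t i))
        (sbpWeight_pos N i).le
      linarith
    have h3 : 0 ≤ (gridSpacing (N + 4))⁻¹ *
        (∑ i ∈ Finset.range (N + 4), sbpWeight N i * e t i * satOp N τ (e t) i) :=
      mul_nonneg (inv_nonneg.2 (gridSpacing_add_four_pos N).le)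
        (sum_mul_satOp_nonneg N τ (e t) hτ)
    have := hR t ht
    rw [h1]
    linarith
  -- Grönwall's argument for `f' ≤ f + M`, with the integrating factor `exp (-s)` applied to `f +
  -- M`.
  have hanti : AntitoneOn (fun s => Real.exp (-s) * (f s + M)) (Icc 0 T) := by
    have hd : ∀ s ∈ Icc (0 : ℝ) T, HasDerivWithinAt (fun s => Real.exp (-s) * (f s + M))
        (Real.exp (-s) * (f' s - (f s + M))) (Icc 0 T) s := by
      intro s hs
      have h1 : HasDerivWithinAt (fun s : ℝ => Real.exp (-s)) (Real.exp (-s) * -1) (Icc 0 T) s :=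
        ((hasDerivAt_neg s).exp).hasDerivWithinAt
      refine (h1.mul ((hder s hs).add_const M)).congr_deriv ?_
      ring
    refine antitoneOn_of_hasDerivWithinAt_nonpos (convex_Icc 0 T)
      (f' := fun s => Real.exp (-s) * (f' s - (f s + M)))
      (fun s hs => (hd s hs).continuousWithinAt) (fun s hs => ?_) (fun s hs => ?_)
    · exact (hd s (interior_subset hs)).mono interior_subset
    · exact mul_nonpos_of_nonneg_of_nonpos (Real.exp_pos _).le
        (by linarith [hle s (interior_subset hs)])
  have h0 := hanti (left_mem_Icc.2 (ht.1.trans ht.2)) ht ht.1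
  simp only [neg_zero, Real.exp_zero, one_mul] at h0
  have hf0 : 0 ≤ f 0 := Finset.sum_nonneg fun i _ =>
    mul_nonneg (sbpWeight_pos N i).le (sq_nonneg _)
  have h4 : f t + M ≤ Real.exp t * (f 0 + M) := by
    calc f t + M = Real.exp t * (Real.exp (-t) * (f t + M)) := by
          rw [← mul_assoc, ← Real.exp_add]; simp
      _ ≤ _ := mul_le_mul_of_nonneg_left h0 (Real.exp_pos _).le
  have h5 : Real.exp t * (f 0 + M) ≤ Real.exp T * (f 0 + M) :=
    mul_le_mul_of_nonneg_right (Real.exp_le_exp.2 ht.2) (by linarith)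
  change f t ≤ Real.exp T * (f 0 + M)
  linarith

/-! ### Taylor estimates -/

/-- Taylor estimates on `s` for a function `G` with first three derivatives `G₁`, `G₂`, `G₃`. -/
structure HasTaylorBounds (s : Set ℝ) (G G₁ G₂ G₃ : ℝ → ℝ) (M : ℝ) : Prop where
  third : ∀ x ∈ s, ∀ y ∈ s,
    |G y - (G x + G₁ x * (y - x) + G₂ x * (y - x) ^ 2 / 2 + G₃ x * (y - x) ^ 3 / 6)|
      ≤ M * |y - x| ^ 4
  second : ∀ x ∈ s, ∀ y ∈ s,
    |G y - (G x + G₁ x * (y - x) + G₂ x * (y - x) ^ 2 / 2)| ≤ M * |y - x| ^ 3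
  deriv : ∀ x ∈ s, ∀ y ∈ s, |G₁ y - (G₁ x + G₂ x * (y - x))| ≤ M * |y - x| ^ 2
  bound_two : ∀ x ∈ s, |G₂ x| ≤ M
  bound_three : ∀ x ∈ s, |G₃ x| ≤ M

/-- The mean value inequality on the segment raises the power by one and keeps the constant `M`.
Factorials are given up, so one constant serves all orders. -/
lemma abs_le_mul_pow_succ {F F' : ℝ → ℝ} {x y M : ℝ} {k : ℕ} (hM : 0 ≤ M)
    (hF : ∀ z, HasDerivAt F (F' z) z) (h0 : F x = 0)
    (hb : ∀ z ∈ uIcc x y, |F' z| ≤ M * |z - x| ^ k) : |F y| ≤ M * |y - x| ^ (k + 1) := by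
  have := (convex_uIcc x y).norm_image_sub_le_of_norm_hasDerivWithin_le
    (f := F) (f' := F') (C := M * |y - x| ^ k) (fun z _ => (hF z).hasDerivWithinAt)
    (fun z hz => (hb z hz).trans (mul_le_mul_of_nonneg_left
      (pow_le_pow_left₀ (abs_nonneg _) (abs_sub_left_of_mem_uIcc hz) k) hM))
    left_mem_uIcc right_mem_uIcc
  rw [h0, sub_zero, Real.norm_eq_abs, Real.norm_eq_abs] at this
  rwa [pow_succ, ← mul_assoc]

lemma exists_hasTaylorBounds (a b : ℝ) {G G₁ G₂ G₃ G₄ : ℝ → ℝ}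
    (h1 : ∀ z, HasDerivAt G (G₁ z) z) (h2 : ∀ z, HasDerivAt G₁ (G₂ z) z)
    (h3 : ∀ z, HasDerivAt G₂ (G₃ z) z) (h4 : ∀ z, HasDerivAt G₃ (G₄ z) z)
    (hc : Continuous G₄) : ∃ M, 0 ≤ M ∧ HasTaylorBounds (Icc a b) G G₁ G₂ G₃ M := by
  have hb : ∀ f : ℝ → ℝ, Continuous f → ∃ C, ∀ x ∈ Icc a b, |f x| ≤ C := fun f hf =>
    isCompact_Icc.exists_bound_of_continuousOn hf.continuousOn
  obtain ⟨C2, hC2⟩ := hb G₂ (continuous_iff_continuousAt.2 fun z => (h3 z).continuousAt)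
  obtain ⟨C3, hC3⟩ := hb G₃ (continuous_iff_continuousAt.2 fun z => (h4 z).continuousAt)
  obtain ⟨C4, hC4⟩ := hb G₄ hc
  -- The `0` secures `0 ≤ M` even when the interval is empty and the bounds say nothing.
  set M := max 0 (max C2 (max C3 C4)) with hMdef
  have hM : 0 ≤ M := le_max_left _ _
  have l2 : C2 ≤ M := (le_max_left _ _).trans (le_max_right _ _)
  have l3 : C3 ≤ M := (le_max_left _ _).trans ((le_max_right _ _).trans (le_max_right _ _))
  have l4 : C4 ≤ M := (le_max_right _ _).trans ((le_max_right _ _).trans (le_max_right _ _))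
  have sub : ∀ {x y z}, x ∈ Icc a b → y ∈ Icc a b → z ∈ uIcc x y → z ∈ Icc a b :=
    fun hx hy hz => ordConnected_Icc.uIcc_subset hx hy hz
  have lin : ∀ (x z c : ℝ), HasDerivAt (fun z => c * (z - x)) c z := fun x z c => by
    simpa using ((hasDerivAt_id z).sub_const x).const_mul c
  have quad : ∀ (x z c : ℝ), HasDerivAt (fun z => c * (z - x) ^ 2 / 2) (c * (z - x)) z :=
    fun x z c => by
      refine (((((hasDerivAt_id z).sub_const x).pow 2).const_mul c).div_const 2).congr_deriv ?_
      simp; ring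
  have cub : ∀ (x z c : ℝ), HasDerivAt (fun z => c * (z - x) ^ 3 / 6) (c * (z - x) ^ 2 / 2) z :=
    fun x z c => by
      refine (((((hasDerivAt_id z).sub_const x).pow 3).const_mul c).div_const 6).congr_deriv ?_
      simp; ring
  have a3 : ∀ x ∈ Icc a b, ∀ y ∈ Icc a b, |G₃ y - G₃ x| ≤ M * |y - x| ^ 1 := fun x hx y hy =>
    abs_le_mul_pow_succ (F := fun z => G₃ z - G₃ x) (k := 0) hM (fun z => (h4 z).sub_const _)
      (sub_self _) fun z hz => by simpa using (hC4 z (sub hx hy hz)).trans l4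
  have a2' : ∀ x ∈ Icc a b, ∀ y ∈ Icc a b, |G₂ y - G₂ x| ≤ M * |y - x| ^ 1 := fun x hx y hy =>
    abs_le_mul_pow_succ (F := fun z => G₂ z - G₂ x) (k := 0) hM (fun z => (h3 z).sub_const _)
      (sub_self _) fun z hz => by simpa using (hC3 z (sub hx hy hz)).trans l3
  have a2 : ∀ x ∈ Icc a b, ∀ y ∈ Icc a b, |G₂ y - (G₂ x + G₃ x * (y - x))| ≤ M * |y - x| ^ 2 :=
    fun x hx y hy =>
    abs_le_mul_pow_succ (F := fun z => G₂ z - (G₂ x + G₃ x * (z - x))) (k := 1) hM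
      (fun z => (h3 z).sub ((lin x z _).const_add _)) (by simp)
      fun z hz => a3 x hx z (sub hx hy hz)
  have a1' : ∀ x ∈ Icc a b, ∀ y ∈ Icc a b, |G₁ y - (G₁ x + G₂ x * (y - x))| ≤ M * |y - x| ^ 2 :=
    fun x hx y hy =>
    abs_le_mul_pow_succ (F := fun z => G₁ z - (G₁ x + G₂ x * (z - x))) (k := 1) hM
      (fun z => (h2 z).sub ((lin x z _).const_add _)) (by simp)
      fun z hz => a2' x hx z (sub hx hy hz)
  have a1 : ∀ x ∈ Icc a b, ∀ y ∈ Icc a b,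
      |G₁ y - (G₁ x + G₂ x * (y - x) + G₃ x * (y - x) ^ 2 / 2)| ≤ M * |y - x| ^ 3 :=
    fun x hx y hy =>
    abs_le_mul_pow_succ (F := fun z => G₁ z - (G₁ x + G₂ x * (z - x) + G₃ x * (z - x) ^ 2 / 2))
      (k := 2) hM
      (fun z => (h2 z).sub (((lin x z _).const_add _).add (quad x z _))) (by simp)
      fun z hz => a2 x hx z (sub hx hy hz)
  refine ⟨M, hM, ⟨fun x hx y hy => ?_, fun x hx y hy => ?_, a1',
    fun x hx => (hC2 x hx).trans l2, fun x hx => (hC3 x hx).trans l3⟩⟩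
  · exact abs_le_mul_pow_succ
      (F := fun z => G z - (G x + G₁ x * (z - x) + G₂ x * (z - x) ^ 2 / 2
        + G₃ x * (z - x) ^ 3 / 6)) (k := 3) hM
      (fun z => (h1 z).sub ((((lin x z _).const_add _).add (quad x z _)).add (cub x z _)))
      (by simp) fun z hz => a1 x hx z (sub hx hy hz)
  · exact abs_le_mul_pow_succ
      (F := fun z => G z - (G x + G₁ x * (z - x) + G₂ x * (z - x) ^ 2 / 2)) (k := 2) hM
      (fun z => (h1 z).sub (((lin x z _).const_add _).add (quad x z _)))
      (by simp) fun z hz => a1' x hx z (sub hx hy hz)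

lemma mul_gridSpacing_eq_one (N : ℕ) : ((N : ℝ) + 3) * gridSpacing (N + 4) = 1 := by
  rw [gridSpacing_add_four]; field_simp

lemma gridPoint_mem_Icc {N i : ℕ} (hi : i < N + 4) :
    (i : ℝ) * gridSpacing (N + 4) ∈ Icc (0 : ℝ) 1 := by
  have h := gridSpacing_add_four_pos N
  refine ⟨by positivity, ?_⟩
  rw [← mul_gridSpacing_eq_one N]
  refine mul_le_mul_of_nonneg_right ?_ h.le
  have : i ≤ N + 3 := by omega
  exact_mod_cast this

lemma gridPoint_sub_mem_Icc {N i : ℕ} (hi : i < N + 4) {T t : ℝ} (ht : t ∈ Icc (0 : ℝ) T) :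
    (i : ℝ) * gridSpacing (N + 4) - t ∈ Icc (-T) 1 :=
  ⟨by linarith [(gridPoint_mem_Icc hi).1, ht.2], by linarith [(gridPoint_mem_Icc hi).2, ht.1]⟩

/-! ### Truncation error, row by row -/

/-- The truncation error of `D_m` for the travelling wave `G (x - t)`. -/
def truncationError (N : ℕ) (G G₁ : ℝ → ℝ) (t : ℝ) (i : ℕ) : ℝ :=
  (gridSpacing (N + 4))⁻¹ * satOp N 0 (fun j => G (j * gridSpacing (N + 4) - t)) i
    - G₁ (i * gridSpacing (N + 4) - t)

section Truncation
variable {N : ℕ} {T t M : ℝ} {G G₁ G₂ G₃ : ℝ → ℝ}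

/-- Writing the remainder as an explicit `r * h ^ 3` turns each consistency computation into a
polynomial identity followed by a linear estimate in the `r`. -/
lemma HasTaylorBounds.eq_second {s : Set ℝ} (hG : HasTaylorBounds s G G₁ G₂ G₃ M) {x y : ℝ}
    (hx : x ∈ s) (hy : y ∈ s) {k h : ℝ} (hk : y - x = k * h) (hh : 0 ≤ h) :
    ∃ r, |r| ≤ M * |k| ^ 3 ∧
      G y = G x + G₁ x * (k * h) + G₂ x * (k * h) ^ 2 / 2 + r * h ^ 3 := by
  rcases hh.eq_or_lt with rfl | hh
  · obtain rfl : y = x := by linarith [hk]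
    exact ⟨0, by have := (abs_nonneg _).trans (hG.bound_two y hy); simp; positivity, by simp⟩
  refine ⟨(G y - (G x + G₁ x * (k * h) + G₂ x * (k * h) ^ 2 / 2)) / h ^ 3, ?_, by field_simp; ring⟩
  have := hG.second x hx y hy
  rw [hk, abs_mul, abs_of_pos hh] at this
  rw [abs_div, abs_of_pos (pow_pos hh 3), div_le_iff₀ (pow_pos hh 3)]
  exact this.trans_eq (by ring)

lemma HasTaylorBounds.eq_deriv {s : Set ℝ} (hG : HasTaylorBounds s G G₁ G₂ G₃ M) {x y : ℝ}
    (hx : x ∈ s) (hy : y ∈ s) {k h : ℝ} (hk : y - x = k * h) (hh : 0 ≤ h) :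
    ∃ r, |r| ≤ M * |k| ^ 2 ∧ G₁ y = G₁ x + G₂ x * (k * h) + r * h ^ 2 := by
  rcases hh.eq_or_lt with rfl | hh
  · obtain rfl : y = x := by linarith [hk]
    exact ⟨0, by have := (abs_nonneg _).trans (hG.bound_two y hy); simp; positivity, by simp⟩
  refine ⟨(G₁ y - (G₁ x + G₂ x * (k * h))) / h ^ 2, ?_, by field_simp; ring⟩
  have := hG.deriv x hx y hy
  rw [hk, abs_mul, abs_of_pos hh] at this
  rw [abs_div, abs_of_pos (pow_pos hh 2), div_le_iff₀ (pow_pos hh 2)]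
  exact this.trans_eq (by ring)

lemma HasTaylorBounds.eq_third {s : Set ℝ} (hG : HasTaylorBounds s G G₁ G₂ G₃ M) {x y : ℝ}
    (hx : x ∈ s) (hy : y ∈ s) {k h : ℝ} (hk : y - x = k * h) (hh : 0 ≤ h) :
    ∃ r, |r| ≤ M * |k| ^ 4 ∧ G y = G x + G₁ x * (k * h) + G₂ x * (k * h) ^ 2 / 2
      + G₃ x * (k * h) ^ 3 / 6 + r * h ^ 4 := by
  rcases hh.eq_or_lt with rfl | hh
  · obtain rfl : y = x := by linarith [hk]
    exact ⟨0, by have := (abs_nonneg _).trans (hG.bound_two y hy); simp; positivity, by simp⟩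
  refine ⟨(G y - (G x + G₁ x * (k * h) + G₂ x * (k * h) ^ 2 / 2 + G₃ x * (k * h) ^ 3 / 6)) / h ^ 4,
    ?_, by field_simp; ring⟩
  have := hG.third x hx y hy
  rw [hk, abs_mul, abs_of_pos hh] at this
  rw [abs_div, abs_of_pos (pow_pos hh 4), div_le_iff₀ (pow_pos hh 4)]
  exact this.trans_eq (by ring)

/-- Third-order consistency; the constant is `2⁴/6 + 1 + 1/3 = 4`. -/
lemma abs_truncationError_interior (hG : HasTaylorBounds (Icc (-T) 1) G G₁ G₂ G₃ M)
    (ht : t ∈ Icc (0 : ℝ) T) {k : ℕ} (hk : k < N) :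
    |truncationError N G G₁ t (k + 2)| ≤ 4 * M * gridSpacing (N + 4) ^ 3 := by
  unfold truncationError
  rw [satOp_interior _ _ _ hk]
  have hmem := fun i (hi : i < N + 4) => gridPoint_sub_mem_Icc hi ht
  have hh := gridSpacing_add_four_pos N
  set h := gridSpacing (N + 4)
  obtain ⟨r0, b0, e0⟩ := hG.eq_third (hmem (k + 2) (by omega)) (hmem k (by omega)) (k := -2) (h := h)
    (by push_cast; ring) hh.le
  obtain ⟨r1, b1, e1⟩ := hG.eq_third (hmem (k + 2) (by omega)) (hmem (k + 1) (by omega))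
    (k := -1) (h := h) (by push_cast; ring) hh.le
  obtain ⟨r3, b3, e3⟩ := hG.eq_third (hmem (k + 2) (by omega)) (hmem (k + 3) (by omega))
    (k := 1) (h := h) (by push_cast; ring) hh.le
  rw [e0, e1, e3]
  norm_num at b0 b1 b3
  set x := ((k + 2 : ℕ) : ℝ) * h - t
  have : h⁻¹ * ((G x + G₁ x * (-2 * h) + G₂ x * (-2 * h) ^ 2 / 2 + G₃ x * (-2 * h) ^ 3 / 6
      + r0 * h ^ 4) / 6 - (G x + G₁ x * (-1 * h) + G₂ x * (-1 * h) ^ 2 / 2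
      + G₃ x * (-1 * h) ^ 3 / 6 + r1 * h ^ 4) + G x / 2 + (G x + G₁ x * (1 * h)
      + G₂ x * (1 * h) ^ 2 / 2 + G₃ x * (1 * h) ^ 3 / 6 + r3 * h ^ 4) / 3) - G₁ x
      = (r0 / 6 - r1 + r3 / 3) * h ^ 3 := by
    field_simp; ring
  rw [this, abs_mul, abs_of_pos (pow_pos hh 3)]
  refine mul_le_mul_of_nonneg_right ?_ (pow_pos hh 3).le
  rw [abs_le] at *
  constructor <;> linarith

lemma abs_truncationError_zero (hG : HasTaylorBounds (Icc (-T) 1) G G₁ G₂ G₃ M)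
    (ht : t ∈ Icc (0 : ℝ) T) :
    |truncationError N G G₁ t 0 - gridSpacing (N + 4) * (G₂ (-t) * (1 / 2))|
      ≤ 13 * M * gridSpacing (N + 4) ^ 2 := by
  unfold truncationError
  rw [satOp_zero]
  have hmem := fun i (hi : i < N + 4) => gridPoint_sub_mem_Icc hi ht
  have hh := gridSpacing_add_four_pos N
  set h := gridSpacing (N + 4)
  obtain ⟨r1, b1, e1⟩ := hG.eq_second (hmem 0 (by omega)) (hmem 1 (by omega)) (k := 1) (h := h)
    (by push_cast; ring) hh.le
  rw [e1]
  norm_num at b1 ⊢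
  have : h⁻¹ * (-G (-t) + (G (-t) + G₁ (-t) * h + G₂ (-t) * h ^ 2 / 2 + r1 * h ^ 3)) - G₁ (-t)
      - h * (G₂ (-t) * (1 / 2)) = r1 * h ^ 2 := by
    field_simp; ring
  rw [this, abs_mul, abs_of_pos (pow_pos hh 2)]
  refine mul_le_mul_of_nonneg_right ?_ (pow_pos hh 2).le
  linarith [abs_nonneg r1]

/-- The expansion is centred at the boundary node rather than at node 1, so that both inflow rows
carry the same amplitude `G₂ (-t)` and one layer can match them. The outflow rows are treated
likewise. -/
lemma abs_truncationError_one (hG : HasTaylorBounds (Icc (-T) 1) G G₁ G₂ G₃ M)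
    (ht : t ∈ Icc (0 : ℝ) T) :
    |truncationError N G G₁ t 1 - gridSpacing (N + 4) * (G₂ (-t) * (-5 / 26))|
      ≤ 13 * M * gridSpacing (N + 4) ^ 2 := by
  unfold truncationError
  rw [satOp_one]
  have hmem := fun i (hi : i < N + 4) => gridPoint_sub_mem_Icc hi ht
  have hh := gridSpacing_add_four_pos N
  set h := gridSpacing (N + 4)
  obtain ⟨r1, b1, e1⟩ := hG.eq_second (hmem 0 (by omega)) (hmem 1 (by omega)) (k := 1) (h := h)
    (by push_cast; ring) hh.le
  obtain ⟨r2, b2, e2⟩ := hG.eq_second (hmem 0 (by omega)) (hmem 2 (by omega)) (k := 2) (h := h)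
    (by push_cast; ring) hh.le
  obtain ⟨s1, c1, d1⟩ := hG.eq_deriv (hmem 0 (by omega)) (hmem 1 (by omega)) (k := 1) (h := h)
    (by push_cast; ring) hh.le
  rw [e1, e2, d1]
  norm_num at b1 b2 c1 ⊢
  have : h⁻¹ * ((-(9 * G (-t)) + 5 * (G (-t) + G₁ (-t) * h + G₂ (-t) * h ^ 2 / 2 + r1 * h ^ 3)
      + 4 * (G (-t) + G₁ (-t) * (2 * h) + G₂ (-t) * (2 * h) ^ 2 / 2 + r2 * h ^ 3)) / 13)
      - (G₁ (-t) + G₂ (-t) * h + s1 * h ^ 2) + h * (G₂ (-t) * (5 / 26))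
      = (5 * r1 / 13 + 4 * r2 / 13 - s1) * h ^ 2 := by
    field_simp; ring
  rw [this, abs_mul, abs_of_pos (pow_pos hh 2)]
  refine mul_le_mul_of_nonneg_right ?_ (pow_pos hh 2).le
  rw [abs_le] at *
  constructor <;> linarith

/-- This row dictates the common constant: `(2·27 + 12·8 + 5)/13 + 1` lies just below `13`. -/
lemma abs_truncationError_penultimate (hG : HasTaylorBounds (Icc (-T) 1) G G₁ G₂ G₃ M)
    (ht : t ∈ Icc (0 : ℝ) T) :
    |truncationError N G G₁ t (N + 2) - gridSpacing (N + 4) * (G₂ (1 - t) * (1 / 26))|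
      ≤ 13 * M * gridSpacing (N + 4) ^ 2 := by
  unfold truncationError
  rw [satOp_penultimate]
  have hmem := fun i (hi : i < N + 4) => gridPoint_sub_mem_Icc hi ht
  have hh := gridSpacing_add_four_pos N
  have hN := mul_gridSpacing_eq_one N
  set h := gridSpacing (N + 4)
  obtain ⟨r0, b0, e0⟩ := hG.eq_second (hmem (N + 3) (by omega)) (hmem N (by omega))
    (k := -3) (h := h) (by push_cast; ring) hh.le
  obtain ⟨r1, b1, e1⟩ := hG.eq_second (hmem (N + 3) (by omega)) (hmem (N + 1) (by omega))
    (k := -2) (h := h) (by push_cast; ring) hh.le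
  obtain ⟨r2, b2, e2⟩ := hG.eq_second (hmem (N + 3) (by omega)) (hmem (N + 2) (by omega))
    (k := -1) (h := h) (by push_cast; ring) hh.le
  obtain ⟨s2, c2, d2⟩ := hG.eq_deriv (hmem (N + 3) (by omega)) (hmem (N + 2) (by omega))
    (k := -1) (h := h) (by push_cast; ring) hh.le
  rw [e0, e1, e2, d2]
  have hx : ((N + 3 : ℕ) : ℝ) * h - t = 1 - t := by push_cast; rw [hN]
  rw [hx]
  norm_num at b0 b1 b2 c2
  set x := 1 - t
  have : h⁻¹ * ((2 * (G x + G₁ x * (-3 * h) + G₂ x * (-3 * h) ^ 2 / 2 + r0 * h ^ 3)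
      - 12 * (G x + G₁ x * (-2 * h) + G₂ x * (-2 * h) ^ 2 / 2 + r1 * h ^ 3)
      + 5 * (G x + G₁ x * (-1 * h) + G₂ x * (-1 * h) ^ 2 / 2 + r2 * h ^ 3) + 5 * G x) / 13)
      - (G₁ x + G₂ x * (-1 * h) + s2 * h ^ 2) - h * (G₂ x * (1 / 26))
      = (2 * r0 / 13 - 12 * r1 / 13 + 5 * r2 / 13 - s2) * h ^ 2 := by
    field_simp; ring
  rw [this, abs_mul, abs_of_pos (pow_pos hh 2)]
  refine mul_le_mul_of_nonneg_right ?_ (pow_pos hh 2).le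
  rw [abs_le] at *
  constructor <;> linarith

lemma abs_truncationError_last (hG : HasTaylorBounds (Icc (-T) 1) G G₁ G₂ G₃ M)
    (ht : t ∈ Icc (0 : ℝ) T) :
    |truncationError N G G₁ t (N + 3) - gridSpacing (N + 4) * (G₂ (1 - t) * (-1 / 10))|
      ≤ 13 * M * gridSpacing (N + 4) ^ 2 := by
  unfold truncationError
  rw [satOp_last]
  have hmem := fun i (hi : i < N + 4) => gridPoint_sub_mem_Icc hi ht
  have hh := gridSpacing_add_four_pos N
  have hN := mul_gridSpacing_eq_one N
  set h := gridSpacing (N + 4)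
  obtain ⟨r1, b1, e1⟩ := hG.eq_second (hmem (N + 3) (by omega)) (hmem (N + 1) (by omega))
    (k := -2) (h := h) (by push_cast; ring) hh.le
  obtain ⟨r2, b2, e2⟩ := hG.eq_second (hmem (N + 3) (by omega)) (hmem (N + 2) (by omega))
    (k := -1) (h := h) (by push_cast; ring) hh.le
  rw [e1, e2]
  have hx : ((N + 3 : ℕ) : ℝ) * h - t = 1 - t := by push_cast; rw [hN]
  rw [hx]
  norm_num at b1 b2
  set x := 1 - t
  have : h⁻¹ * ((2 * (G x + G₁ x * (-2 * h) + G₂ x * (-2 * h) ^ 2 / 2 + r1 * h ^ 3)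
      - 9 * (G x + G₁ x * (-1 * h) + G₂ x * (-1 * h) ^ 2 / 2 + r2 * h ^ 3) + 7 * G x) / 5)
      - G₁ x - h * (G₂ x * (-1 / 10))
      = (2 * r1 / 5 - 9 * r2 / 5) * h ^ 2 := by
    field_simp; ring
  rw [this, abs_mul, abs_of_pos (pow_pos hh 2)]
  refine mul_le_mul_of_nonneg_right ?_ (pow_pos hh 2).le
  rw [abs_le] at *
  constructor <;> linarith

end Truncation

/-! ### Subtracting the boundary layers -/

/-- `φ` is an approximate steady boundary layer: `satOp N τ φ` equals the closure data
`w₀, w₁, w₂, w₃` up to `O(h)` in the four closure rows and vanishes in the interior. -/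
structure IsBoundaryLayer (N : ℕ) (τ K S w₀ w₁ w₂ w₃ : ℝ) (φ : ℕ → ℝ) : Prop where
  zero : |satOp N τ φ 0 - w₀| ≤ K * gridSpacing (N + 4)
  one : |satOp N τ φ 1 - w₁| ≤ K * gridSpacing (N + 4)
  interior : ∀ k < N, satOp N τ φ (k + 2) = 0
  penultimate : |satOp N τ φ (N + 2) - w₂| ≤ K * gridSpacing (N + 4)
  last : |satOp N τ φ (N + 3) - w₃| ≤ K * gridSpacing (N + 4)
  bound : ∀ i, |φ i| ≤ K
  sum_sq : ∑ i ∈ Finset.range (N + 4), φ i ^ 2 ≤ S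

section Upper
variable {N : ℕ} {τ T M K S : ℝ} {G G₁ G₂ G₃ : ℝ → ℝ} {φ ψ : ℕ → ℝ}

lemma gridSpacing_add_four_le_one (N : ℕ) : gridSpacing (N + 4) ≤ 1 := by
  rw [gridSpacing_add_four, div_le_one (by positivity)]
  have : (0 : ℝ) ≤ N := N.cast_nonneg
  linarith

/-- What remains of the truncation error after the boundary layers are subtracted. -/
def layerResidual (N : ℕ) (τ : ℝ) (G G₁ G₂ G₃ : ℝ → ℝ) (φ ψ : ℕ → ℝ) (t : ℝ) (i : ℕ) : ℝ :=
  truncationError N G G₁ t i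
    + gridSpacing (N + 4) ^ 2 * (G₃ (-t) * φ i + G₃ (1 - t) * ψ i)
    - gridSpacing (N + 4) * (G₂ (-t) * satOp N τ φ i + G₂ (1 - t) * satOp N τ ψ i)

/-- The operator, scaled by `h⁻¹`, turns the `h²` layers into terms of order `h` that cancel the
leading closure errors. The time derivative of the amplitudes only costs the `h² G₃` terms. -/
lemma SolvesForced.sub_layers (h3 : ∀ z, HasDerivAt G₂ (G₃ z) z) {e : ℝ → ℕ → ℝ}
    (he : SolvesForced N τ T e (truncationError N G G₁)) :
    SolvesForced N τ T
      (fun t i => e t i - gridSpacing (N + 4) ^ 2 * (G₂ (-t) * φ i + G₂ (1 - t) * ψ i))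
      (layerResidual N τ G G₁ G₂ G₃ φ ψ) := by
  intro i hi t ht
  have d1 : HasDerivAt (fun s : ℝ => G₂ (-s)) (-G₃ (-t)) t := by
    simpa [Function.comp_def] using (h3 (-t)).comp t (hasDerivAt_neg t)
  have d2 : HasDerivAt (fun s : ℝ => G₂ (1 - s)) (-G₃ (1 - t)) t := by
    simpa [Function.comp_def] using (h3 (1 - t)).comp t ((hasDerivAt_id t).const_sub 1)
  have d3 := (((d1.mul_const (φ i)).add (d2.mul_const (ψ i))).const_mul
    (gridSpacing (N + 4) ^ 2)).hasDerivWithinAt (s := Icc 0 T)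
  refine ((he i hi t ht).sub d3).congr_deriv ?_
  rw [satOp_sub, satOp_smul, satOp_add, satOp_smul, satOp_smul, layerResidual]
  have hh := (gridSpacing_add_four_pos N).ne'
  field_simp
  ring

lemma abs_residual_closure_le {X h α β p q f g x y a b M K : ℝ} (hh : 0 ≤ h)
    (hX : |X - h * (α * a + β * b)| ≤ 13 * M * h ^ 2)
    (hα : |α| ≤ M) (hβ : |β| ≤ M) (hp : |p| ≤ M) (hq : |q| ≤ M) (hf : |f| ≤ K) (hg : |g| ≤ K)
    (hx : |x - a| ≤ K * h) (hy : |y - b| ≤ K * h) :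
    |X + h ^ 2 * (p * f + q * g) - h * (α * x + β * y)| ≤ (13 * M + 4 * M * K) * h ^ 2 := by
  have _ : 0 ≤ M := (abs_nonneg _).trans hα
  have e : X + h ^ 2 * (p * f + q * g) - h * (α * x + β * y)
      = (X - h * (α * a + β * b)) + h ^ 2 * (p * f) + h ^ 2 * (q * g)
        - h * (α * (x - a)) - h * (β * (y - b)) := by ring
  have m1 : |h ^ 2 * (p * f)| ≤ h ^ 2 * (M * K) := by
    rw [abs_mul, abs_of_nonneg (sq_nonneg h), abs_mul]; gcongr
  have m2 : |h ^ 2 * (q * g)| ≤ h ^ 2 * (M * K) := by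
    rw [abs_mul, abs_of_nonneg (sq_nonneg h), abs_mul]; gcongr
  have m3 : |h * (α * (x - a))| ≤ h * (M * (K * h)) := by
    rw [abs_mul, abs_of_nonneg hh, abs_mul]; gcongr
  have m4 : |h * (β * (y - b))| ≤ h * (M * (K * h)) := by
    rw [abs_mul, abs_of_nonneg hh, abs_mul]; gcongr
  rw [e]
  rw [abs_le] at *
  constructor <;> linarith

/-- The four closure rows contribute `2A²h⁴` each, with `A = 13M + 4MK`. In the interior `(x + y +
z)² ≤ 3(x² + y² + z²)` gives `48 = 3·4²` from the truncation error, and the drift of the layers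
contributes a multiple of `h⁴ S`. -/
lemma sum_layerResidual_sq_le (hM : 0 ≤ M) (hG : HasTaylorBounds (Icc (-T) 1) G G₁ G₂ G₃ M)
    (hφ : IsBoundaryLayer N τ K S (1 / 2) (-5 / 26) 0 0 φ)
    (hψ : IsBoundaryLayer N τ K S 0 0 (1 / 26) (-1 / 10) ψ) {t : ℝ} (ht : t ∈ Icc (0 : ℝ) T) :
    ∑ i ∈ Finset.range (N + 4), sbpWeight N i * layerResidual N τ G G₁ G₂ G₃ φ ψ t i ^ 2
      ≤ (8 * (13 * M + 4 * M * K) ^ 2 + 48 * M ^ 2) * (gridSpacing (N + 4) ^ 4 * (1 + S)) := by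
  have hh := gridSpacing_add_four_pos N
  have hh1 := gridSpacing_add_four_le_one N
  have hNh := mul_gridSpacing_eq_one N
  have mem0 : -t ∈ Icc (-T) 1 := ⟨by linarith [ht.2], by linarith [ht.1]⟩
  have mem1 : 1 - t ∈ Icc (-T) 1 := ⟨by linarith [ht.2], by linarith [ht.1]⟩
  have hT0 := abs_truncationError_zero (N := N) hG ht
  have hT1 := abs_truncationError_one (N := N) hG ht
  have hT2 := abs_truncationError_penultimate (N := N) hG ht
  have hT3 := abs_truncationError_last (N := N) hG ht
  have hTi := fun k (hk : k < N) => abs_truncationError_interior hG ht hk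
  have hS : 0 ≤ S := (Finset.sum_nonneg fun i _ => sq_nonneg (φ i)).trans hφ.sum_sq
  set h := gridSpacing (N + 4) with hdef
  set R := layerResidual N τ G G₁ G₂ G₃ φ ψ t with hR
  set A := 13 * M + 4 * M * K with hA
  have sq_le : ∀ i, |R i| ≤ A * h ^ 2 → sbpWeight N i * R i ^ 2 ≤ 2 * A ^ 2 * h ^ 4 := by
    intro i hi
    have h1 : R i ^ 2 ≤ (A * h ^ 2) ^ 2 := sq_le_sq' (by linarith [abs_le.1 hi]) (abs_le.1 hi).2
    have h2 : sbpWeight N i ≤ 2 := by linarith [sbpWeight_le N i]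
    calc sbpWeight N i * R i ^ 2 ≤ 2 * (A * h ^ 2) ^ 2 :=
          mul_le_mul h2 h1 (sq_nonneg _) (by norm_num)
      _ = _ := by ring
  have b0 : |R 0| ≤ A * h ^ 2 :=
    abs_residual_closure_le hh.le (by simpa using hT0) (hG.bound_two _ mem0) (hG.bound_two _ mem1)
      (hG.bound_three _ mem0) (hG.bound_three _ mem1) (hφ.bound 0) (hψ.bound 0) hφ.zero hψ.zero
  have b1 : |R 1| ≤ A * h ^ 2 :=
    abs_residual_closure_le hh.le (by simpa using hT1) (hG.bound_two _ mem0) (hG.bound_two _ mem1)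
      (hG.bound_three _ mem0) (hG.bound_three _ mem1) (hφ.bound 1) (hψ.bound 1) hφ.one hψ.one
  have b2 : |R (N + 2)| ≤ A * h ^ 2 :=
    abs_residual_closure_le hh.le (by simpa using hT2) (hG.bound_two _ mem0) (hG.bound_two _ mem1)
      (hG.bound_three _ mem0) (hG.bound_three _ mem1) (hφ.bound _) (hψ.bound _)
      hφ.penultimate hψ.penultimate
  have b3 : |R (N + 3)| ≤ A * h ^ 2 :=
    abs_residual_closure_le hh.le (by simpa using hT3) (hG.bound_two _ mem0) (hG.bound_two _ mem1)
      (hG.bound_three _ mem0) (hG.bound_three _ mem1) (hφ.bound _) (hψ.bound _)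
      hφ.last hψ.last
  have bi : ∀ k ∈ Finset.range N, sbpWeight N (k + 2) * R (k + 2) ^ 2
      ≤ 48 * M ^ 2 * h ^ 6 + 3 * M ^ 2 * h ^ 4 * φ (k + 2) ^ 2
        + 3 * M ^ 2 * h ^ 4 * ψ (k + 2) ^ 2 := by
    intro k hk
    rw [Finset.mem_range] at hk
    rw [sbpWeight_interior N hk, one_mul, hR, layerResidual, hφ.interior k hk, hψ.interior k hk]
    have hsq : ∀ {a b : ℝ}, |a| ≤ b → a ^ 2 ≤ b ^ 2 := fun hab =>
      sq_le_sq' (by linarith [abs_le.1 hab]) (abs_le.1 hab).2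
    have s1 := hsq (hTi k hk)
    have s2 := mul_le_mul_of_nonneg_right (hsq (hG.bound_three _ mem0))
      (mul_nonneg (pow_nonneg hh.le 4) (sq_nonneg (φ (k + 2))))
    have s3 := mul_le_mul_of_nonneg_right (hsq (hG.bound_three _ mem1))
      (mul_nonneg (pow_nonneg hh.le 4) (sq_nonneg (ψ (k + 2))))
    have key : ∀ x y z : ℝ, (x + y + z) ^ 2 ≤ 3 * (x ^ 2 + y ^ 2 + z ^ 2) := fun x y z => by
      nlinarith [sq_nonneg (x - y), sq_nonneg (y - z), sq_nonneg (x - z)]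
    have := key (truncationError N G G₁ t (k + 2)) (h ^ 2 * (G₃ (-t) * φ (k + 2)))
      (h ^ 2 * (G₃ (1 - t) * ψ (k + 2)))
    calc _ = (truncationError N G G₁ t (k + 2) + h ^ 2 * (G₃ (-t) * φ (k + 2))
          + h ^ 2 * (G₃ (1 - t) * ψ (k + 2))) ^ 2 := by rw [← hdef]; ring
      _ ≤ _ := by linarith
  have tail : ∀ f : ℕ → ℝ, ∑ i ∈ Finset.range (N + 4), f i ^ 2 ≤ S →
      ∑ k ∈ Finset.range N, f (k + 2) ^ 2 ≤ S := fun f hf => by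
    rw [sum_range_add_four] at hf
    linarith [sq_nonneg (f 0), sq_nonneg (f 1), sq_nonneg (f (N + 2)), sq_nonneg (f (N + 3))]
  have hsum := Finset.sum_le_sum bi
  rw [Finset.sum_add_distrib, Finset.sum_add_distrib, Finset.sum_const, Finset.card_range,
    nsmul_eq_mul, ← Finset.mul_sum, ← Finset.mul_sum] at hsum
  have t1 := mul_le_mul_of_nonneg_left (tail φ hφ.sum_sq)
    (mul_nonneg (mul_nonneg (by norm_num : (0 : ℝ) ≤ 3) (sq_nonneg M)) (pow_nonneg hh.le 4))
  have t2 := mul_le_mul_of_nonneg_left (tail ψ hψ.sum_sq)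
    (mul_nonneg (mul_nonneg (by norm_num : (0 : ℝ) ≤ 3) (sq_nonneg M)) (pow_nonneg hh.le 4))
  -- The number of interior nodes is paid for by one factor `h`, and a second factor `h` is
  -- discarded.
  have t3 : (N : ℝ) * (48 * M ^ 2 * h ^ 6) ≤ 48 * M ^ 2 * h ^ 4 := by
    have : (N : ℝ) * h * h ≤ 1 := by nlinarith
    calc (N : ℝ) * (48 * M ^ 2 * h ^ 6) = (48 * M ^ 2 * h ^ 4) * (N * h * h) := by ring
      _ ≤ (48 * M ^ 2 * h ^ 4) * 1 := by gcongr
      _ = _ := mul_one _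
  rw [sum_range_add_four]
  have c0 := sq_le 0 b0
  have c1 := sq_le 1 b1
  have c2 := sq_le _ b2
  have c3 := sq_le _ b3
  have pos1 : 0 ≤ A ^ 2 * (h ^ 4 * S) := by positivity
  have pos2 : 0 ≤ M ^ 2 * (h ^ 4 * S) := by positivity
  linarith

/-- The error is bounded by the size of the boundary layers. -/
lemma sum_error_sq_le (hτ : τ ≤ -1 / 2) (hM : 0 ≤ M)
    (hG : HasTaylorBounds (Icc (-T) 1) G G₁ G₂ G₃ M) (h3 : ∀ z, HasDerivAt G₂ (G₃ z) z)
    (hφ : IsBoundaryLayer N τ K S (1 / 2) (-5 / 26) 0 0 φ)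
    (hψ : IsBoundaryLayer N τ K S 0 0 (1 / 26) (-1 / 10) ψ)
    {e : ℝ → ℕ → ℝ} (he : SolvesForced N τ T e (truncationError N G G₁))
    (he0 : ∀ i < N + 4, e 0 i = 0) {t : ℝ} (ht : t ∈ Icc (0 : ℝ) T) :
    ∑ i ∈ Finset.range (N + 4), e t i ^ 2
      ≤ (6 * Real.exp T * (8 * M ^ 2 + (8 * (13 * M + 4 * M * K) ^ 2 + 48 * M ^ 2)) + 8 * M ^ 2)
        * (gridSpacing (N + 4) ^ 4 * (1 + S)) := by
  have hS : 0 ≤ S := (Finset.sum_nonneg fun i _ => sq_nonneg (φ i)).trans hφ.sum_sq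
  have hd := he.sub_layers (φ := φ) (ψ := ψ) h3
  set h := gridSpacing (N + 4) with hdef
  set B := h ^ 4 * (1 + S) with hB
  have hB0 : 0 ≤ B := by positivity
  have hSB : h ^ 4 * S ≤ B := by
    have : 0 ≤ h ^ 4 := by positivity
    rw [hB]; linarith
  set C := 8 * (13 * M + 4 * M * K) ^ 2 + 48 * M ^ 2 with hC
  set c : ℝ → ℕ → ℝ := fun t i => h ^ 2 * (G₂ (-t) * φ i + G₂ (1 - t) * ψ i) with hc
  have hcb : ∀ t ∈ Icc (0 : ℝ) T, ∑ i ∈ Finset.range (N + 4), c t i ^ 2 ≤ 4 * M ^ 2 * B := by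
    intro t ht
    have hsq : ∀ x ∈ Icc (-T) 1, G₂ x ^ 2 ≤ M ^ 2 := fun x hx =>
      sq_le_sq' (by linarith [abs_le.1 (hG.bound_two x hx)]) (abs_le.1 (hG.bound_two x hx)).2
    have s0 := hsq (-t) ⟨by linarith [ht.2], by linarith [ht.1]⟩
    have s1 := hsq (1 - t) ⟨by linarith [ht.2], by linarith [ht.1]⟩
    have : ∀ i ∈ Finset.range (N + 4),
        c t i ^ 2 ≤ 2 * M ^ 2 * h ^ 4 * φ i ^ 2 + 2 * M ^ 2 * h ^ 4 * ψ i ^ 2 := by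
      intro i _
      have u0 := mul_le_mul_of_nonneg_right s0
        (mul_nonneg (by positivity : 0 ≤ h ^ 4) (sq_nonneg (φ i)))
      have u1 := mul_le_mul_of_nonneg_right s1
        (mul_nonneg (by positivity : 0 ≤ h ^ 4) (sq_nonneg (ψ i)))
      have := add_sq_le (a := h ^ 2 * (G₂ (-t) * φ i)) (b := h ^ 2 * (G₂ (1 - t) * ψ i))
      calc c t i ^ 2 = (h ^ 2 * (G₂ (-t) * φ i) + h ^ 2 * (G₂ (1 - t) * ψ i)) ^ 2 := by
            rw [hc]; ring
        _ ≤ _ := by linarith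
    refine (Finset.sum_le_sum this).trans ?_
    rw [Finset.sum_add_distrib, ← Finset.mul_sum, ← Finset.mul_sum]
    have nn : 0 ≤ 2 * M ^ 2 * h ^ 4 := by positivity
    have v0 := mul_le_mul_of_nonneg_left hφ.sum_sq nn
    have v1 := mul_le_mul_of_nonneg_left hψ.sum_sq nn
    have := mul_le_mul_of_nonneg_left hSB (by positivity : 0 ≤ 4 * M ^ 2)
    linarith
  have h0 : (0 : ℝ) ∈ Icc (0 : ℝ) T := ⟨le_rfl, ht.1.trans ht.2⟩
  have init : ∑ i ∈ Finset.range (N + 4), sbpWeight N i * (e 0 i - c 0 i) ^ 2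
      ≤ 8 * M ^ 2 * B := by
    calc _ ≤ ∑ i ∈ Finset.range (N + 4), 2 * c 0 i ^ 2 := by
          refine Finset.sum_le_sum fun i hi => ?_
          rw [he0 i (Finset.mem_range.1 hi), zero_sub, neg_sq]
          exact mul_le_mul_of_nonneg_right (by linarith [sbpWeight_le N i]) (sq_nonneg _)
      _ = 2 * ∑ i ∈ Finset.range (N + 4), c 0 i ^ 2 := by rw [Finset.mul_sum]
      _ ≤ _ := by linarith [hcb 0 h0]
  have hE := hd.energy_le hτ (M := C * B) (by positivity)
    (fun t ht => sum_layerResidual_sq_le hM hG hφ hψ ht) ht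
  have hE2 : ∑ i ∈ Finset.range (N + 4), sbpWeight N i * (e t i - c t i) ^ 2
      ≤ Real.exp T * (8 * M ^ 2 * B + C * B) :=
    hE.trans (mul_le_mul_of_nonneg_left (by linarith [init]) (Real.exp_pos _).le)
  -- The factor `6` exceeds `2 · 12/5`: two from squaring a sum, `12/5` from the smallest weight.
  have hE3 : ∑ i ∈ Finset.range (N + 4), e t i ^ 2
      ≤ ∑ i ∈ Finset.range (N + 4),
        (6 * (sbpWeight N i * (e t i - c t i) ^ 2) + 2 * c t i ^ 2) := by
    refine Finset.sum_le_sum fun i _ => ?_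
    have u := mul_le_mul_of_nonneg_right (sbpWeight_ge N i) (sq_nonneg (e t i - c t i))
    have v := add_sq_le (a := e t i - c t i) (b := c t i)
    rw [sub_add_cancel] at v
    linarith [sq_nonneg (e t i - c t i)]
  rw [Finset.sum_add_distrib, ← Finset.mul_sum, ← Finset.mul_sum] at hE3
  have := hcb t ht
  linarith

end Upper

/-! ### Explicit boundary layers -/

/-- The decaying root `κ` of the interior stencil. -/
def stencilRoot : ℝ := (Real.sqrt 33 - 5) / 4

/-- This is the quadratic factor left after removing the root `1` of constants from the stencil
polynomial. Its other root is `-1/(2κ)`, so modes decaying away from the outflow have ratio `-2κ`.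
-/
lemma stencilRoot_eq : 2 * stencilRoot ^ 2 + 5 * stencilRoot - 1 = 0 := by
  have := Real.sq_sqrt (show (0 : ℝ) ≤ 33 by norm_num)
  unfold stencilRoot
  nlinarith

lemma stencilRoot_pos : 0 < stencilRoot := by
  have : (5 : ℝ) < Real.sqrt 33 := Real.lt_sqrt_of_sq_lt (by norm_num)
  unfold stencilRoot; linarith

/-- With this bound `κ` and `2κ` are both below `1/2`, so every layer mode is dominated by powers of
`1/2`. -/
lemma stencilRoot_lt : stencilRoot < 1 / 5 := by
  have : Real.sqrt 33 < 29 / 5 := by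
    rw [Real.sqrt_lt' (by norm_num)]; norm_num
  unfold stencilRoot; linarith

/-- Bernoulli's inequality; it absorbs the exponentially small tail of a layer at the opposite end
into the tolerance `K h` of `IsBoundaryLayer`. -/
lemma half_pow_le (N : ℕ) : (1 / 2 : ℝ) ^ N ≤ 3 * gridSpacing (N + 4) := by
  rw [gridSpacing_add_four]
  have h1 : (N : ℝ) + 1 ≤ 2 ^ N := by
    have := one_add_mul_le_pow (a := (1 : ℝ)) (by norm_num) N
    norm_num at this
    linarith
  rw [one_div_pow, mul_one_div, div_le_div_iff₀ (by positivity) (by positivity)]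
  nlinarith

lemma sum_half_pow_le (n : ℕ) : ∑ i ∈ Finset.range n, (1 / 2 : ℝ) ^ i ≤ 2 := by
  have : ∀ n : ℕ, ∑ i ∈ Finset.range n, (1 / 2 : ℝ) ^ i = 2 - 2 * (1 / 2) ^ n := by
    intro n
    induction n with
    | zero => simp
    | succ n ih => rw [Finset.sum_range_succ, ih, pow_succ]; ring
  rw [this]
  have : (0 : ℝ) < (1 / 2) ^ n := by positivity
  linarith

/-- The inflow boundary layer: a constant plus a decaying mode. -/
def inflowLayer (τ : ℝ) (j : ℕ) : ℝ :=
  5 / (2 * (7 + 5 * stencilRoot)) * (-(1 + 1 / τ) + stencilRoot ^ j)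

/-- The outflow boundary layer. -/
def outflowLayer (N j : ℕ) : ℝ :=
  if j ≤ N + 2 then (-2 * stencilRoot) ^ (N + 2 - j) / (18 + 8 * stencilRoot)
  else (-1 / 2 + (4 * stencilRoot + 9) / (18 + 8 * stencilRoot)) / 7

/-- Row 1 annihilates constants and so fixes the amplitude of `κ ^ j`; row 0, where the penalty sees
constants, then fixes the constant part as a multiple of `1 + 1/τ`. -/
lemma satOp_inflowLayer_zero (N : ℕ) {τ : ℝ} (hτ : τ ≠ 0) :
    satOp N τ (inflowLayer τ) 0 = 1 / 2 := by
  have h := stencilRoot_pos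
  have : 7 + 5 * stencilRoot ≠ 0 := by positivity
  rw [satOp_zero, inflowLayer, inflowLayer]
  field_simp
  ring

lemma satOp_inflowLayer_one (N : ℕ) (τ : ℝ) : satOp N τ (inflowLayer τ) 1 = -5 / 26 := by
  have h := stencilRoot_pos
  have : 7 + 5 * stencilRoot ≠ 0 := by positivity
  rw [satOp_one]
  unfold inflowLayer
  have e := stencilRoot_eq
  set κ := stencilRoot
  have : (-9 * (5 / (2 * (7 + 5 * κ)) * (-(1 + 1 / τ) + κ ^ 0))
      + 5 * (5 / (2 * (7 + 5 * κ)) * (-(1 + 1 / τ) + κ ^ 1))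
      + 4 * (5 / (2 * (7 + 5 * κ)) * (-(1 + 1 / τ) + κ ^ 2))) / 13
      = (5 / (2 * (7 + 5 * κ))) * (2 * (2 * κ ^ 2 + 5 * κ - 1) - (7 + 5 * κ)) / 13 := by ring
  rw [this, e]
  field_simp
  ring

lemma satOp_inflowLayer_interior {N k : ℕ} (τ : ℝ) (hk : k < N) :
    satOp N τ (inflowLayer τ) (k + 2) = 0 := by
  rw [satOp_interior _ _ _ hk]
  unfold inflowLayer
  have e := stencilRoot_eq
  set κ := stencilRoot
  set A := 5 / (2 * (7 + 5 * κ))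
  have : A * (-(1 + 1 / τ) + κ ^ k) / 6 - A * (-(1 + 1 / τ) + κ ^ (k + 1))
      + A * (-(1 + 1 / τ) + κ ^ (k + 2)) / 2 + A * (-(1 + 1 / τ) + κ ^ (k + 3)) / 3
      = A * κ ^ k * (κ - 1) * (2 * κ ^ 2 + 5 * κ - 1) / 6 := by ring
  rw [this, e]; simp

lemma abs_satOp_inflowLayer_penultimate (N : ℕ) (τ : ℝ) :
    |satOp N τ (inflowLayer τ) (N + 2)| ≤ (1 / 2) ^ N := by
  have h0 := stencilRoot_pos
  have h1 := stencilRoot_lt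
  rw [satOp_penultimate]
  unfold inflowLayer
  set κ := stencilRoot
  have hA : 5 / (2 * (7 + 5 * κ)) ≤ 1 := by rw [div_le_one (by positivity)]; linarith
  have hA0 : 0 < 5 / (2 * (7 + 5 * κ)) := by positivity
  set A := 5 / (2 * (7 + 5 * κ))
  have : (2 * (A * (-(1 + 1 / τ) + κ ^ N)) - 12 * (A * (-(1 + 1 / τ) + κ ^ (N + 1)))
      + 5 * (A * (-(1 + 1 / τ) + κ ^ (N + 2))) + 5 * (A * (-(1 + 1 / τ) + κ ^ (N + 3)))) / 13
      = A * ((2 - 12 * κ + 5 * κ ^ 2 + 5 * κ ^ 3) / 13) * κ ^ N := by ring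
  rw [this, abs_mul, abs_mul, abs_of_pos hA0, abs_of_pos (pow_pos h0 N)]
  have hb : |(2 - 12 * κ + 5 * κ ^ 2 + 5 * κ ^ 3) / 13| ≤ 1 := by
    have : κ ^ 2 ≤ 1 := by nlinarith
    have : κ ^ 3 ≤ 1 := pow_le_one₀ h0.le (by linarith)
    rw [abs_le]; constructor <;> nlinarith [pow_pos h0 3, pow_pos h0 2]
  have hk : κ ^ N ≤ (1 / 2) ^ N := pow_le_pow_left₀ h0.le (by linarith) N
  calc _ ≤ 1 * 1 * (1 / 2 : ℝ) ^ N := by gcongr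
    _ = _ := by ring

lemma abs_satOp_inflowLayer_last (N : ℕ) (τ : ℝ) :
    |satOp N τ (inflowLayer τ) (N + 3)| ≤ (1 / 2) ^ N := by
  have h0 := stencilRoot_pos
  have h1 := stencilRoot_lt
  rw [satOp_last]
  unfold inflowLayer
  set κ := stencilRoot
  have hA : 5 / (2 * (7 + 5 * κ)) ≤ 1 := by rw [div_le_one (by positivity)]; linarith
  have hA0 : 0 < 5 / (2 * (7 + 5 * κ)) := by positivity
  set A := 5 / (2 * (7 + 5 * κ))
  have : (2 * (A * (-(1 + 1 / τ) + κ ^ (N + 1))) - 9 * (A * (-(1 + 1 / τ) + κ ^ (N + 2)))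
      + 7 * (A * (-(1 + 1 / τ) + κ ^ (N + 3)))) / 5
      = A * ((2 * κ - 9 * κ ^ 2 + 7 * κ ^ 3) / 5) * κ ^ N := by ring
  rw [this, abs_mul, abs_mul, abs_of_pos hA0, abs_of_pos (pow_pos h0 N)]
  have hb : |(2 * κ - 9 * κ ^ 2 + 7 * κ ^ 3) / 5| ≤ 1 := by
    have : κ ^ 2 ≤ 1 / 5 := by nlinarith
    have : κ ^ 3 ≤ 1 / 5 := by nlinarith
    rw [abs_le]; constructor <;> nlinarith [pow_pos h0 3, pow_pos h0 2]
  have hk : κ ^ N ≤ (1 / 2) ^ N := pow_le_pow_left₀ h0.le (by linarith) N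
  calc _ ≤ 1 * 1 * (1 / 2 : ℝ) ^ N := by gcongr
    _ = _ := by ring

lemma inflowLayer_sq_le (τ : ℝ) (j : ℕ) :
    inflowLayer τ j ^ 2 ≤ 2 * (1 + 1 / τ) ^ 2 + 2 * (1 / 2) ^ j := by
  have h0 := stencilRoot_pos
  have h1 := stencilRoot_lt
  unfold inflowLayer
  set κ := stencilRoot
  have hA : 5 / (2 * (7 + 5 * κ)) ≤ 1 := by rw [div_le_one (by positivity)]; linarith
  have hA0 : 0 < 5 / (2 * (7 + 5 * κ)) := by positivity
  set A := 5 / (2 * (7 + 5 * κ))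
  have hk : κ ^ j ≤ (1 / 2) ^ j := pow_le_pow_left₀ h0.le (by linarith) j
  have hk1 : κ ^ j ≤ 1 := pow_le_one₀ h0.le (by linarith)
  have hk0 : 0 ≤ κ ^ j := by positivity
  have hsq : (κ ^ j) ^ 2 ≤ (1 / 2) ^ j := by nlinarith
  have hA2 : A ^ 2 ≤ 1 := by nlinarith
  rw [mul_pow]
  have := add_sq_le (a := -(1 + 1 / τ)) (b := κ ^ j)
  nlinarith [sq_nonneg (-(1 + 1 / τ) + κ ^ j)]

lemma abs_inflowLayer_le (τ : ℝ) (j : ℕ) : |inflowLayer τ j| ≤ |1 + 1 / τ| + 1 := by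
  have h0 := stencilRoot_pos
  have h1 := stencilRoot_lt
  unfold inflowLayer
  set κ := stencilRoot
  have hA : 5 / (2 * (7 + 5 * κ)) ≤ 1 := by rw [div_le_one (by positivity)]; linarith
  have hA0 : 0 < 5 / (2 * (7 + 5 * κ)) := by positivity
  have hk1 : κ ^ j ≤ 1 := pow_le_one₀ h0.le (by linarith)
  have hk0 : 0 ≤ κ ^ j := by positivity
  rw [abs_mul, abs_of_pos hA0]
  have hb : |-(1 + 1 / τ) + κ ^ j| ≤ |1 + 1 / τ| + 1 := by
    refine (abs_add_le _ _).trans ?_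
    rw [abs_neg, abs_of_nonneg hk0]; linarith
  calc _ ≤ 1 * (|1 + 1 / τ| + 1) := by gcongr
    _ = _ := one_mul _

lemma outflowLayer_of_le {N j m : ℕ} (h : j + m = N + 2) :
    outflowLayer N j = (-2 * stencilRoot) ^ m / (18 + 8 * stencilRoot) := by
  rw [outflowLayer, if_pos (by omega), show N + 2 - j = m by omega]

lemma outflowLayer_last (N : ℕ) : outflowLayer N (N + 3)
    = (-1 / 2 + (4 * stencilRoot + 9) / (18 + 8 * stencilRoot)) / 7 := by
  simp [outflowLayer]

lemma satOp_outflowLayer_interior {N k : ℕ} (τ : ℝ) (hk : k < N) :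
    satOp N τ (outflowLayer N) (k + 2) = 0 := by
  obtain ⟨m, rfl⟩ := Nat.exists_eq_add_of_lt hk
  rw [satOp_interior _ _ _ hk, outflowLayer_of_le (j := k) (m := m + 3) (by omega),
    outflowLayer_of_le (j := k + 1) (m := m + 2) (by omega),
    outflowLayer_of_le (j := k + 2) (m := m + 1) (by omega),
    outflowLayer_of_le (j := k + 3) (m := m) (by omega)]
  have e := stencilRoot_eq
  set κ := stencilRoot
  set B := 18 + 8 * κ
  have : (-2 * κ) ^ (m + 3) / B / 6 - (-2 * κ) ^ (m + 2) / B + (-2 * κ) ^ (m + 1) / B / 2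
      + (-2 * κ) ^ m / B / 3
      = (-2 * κ) ^ m / B * (-2 * κ - 1) * (2 * κ ^ 2 + 5 * κ - 1) / 3 := by ring
  rw [this, e]; simp

/-- Interior rows reach only up to node `N + 2`, so the last value is free. The two outflow rows
determine it together with the amplitude; its expression in `κ` in fact simplifies to `0`. -/
lemma satOp_outflowLayer_penultimate (N : ℕ) (τ : ℝ) :
    satOp N τ (outflowLayer N) (N + 2) = 1 / 26 := by
  rw [satOp_penultimate, outflowLayer_of_le (j := N) (m := 2) (by omega),
    outflowLayer_of_le (j := N + 1) (m := 1) (by omega),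
    outflowLayer_of_le (j := N + 2) (m := 0) (by omega), outflowLayer_last]
  have e := stencilRoot_eq
  have h0 := stencilRoot_pos
  set κ := stencilRoot
  have : 18 + 8 * κ ≠ 0 := by positivity
  field_simp
  linear_combination 1456 * e

lemma satOp_outflowLayer_last (N : ℕ) (τ : ℝ) :
    satOp N τ (outflowLayer N) (N + 3) = -1 / 10 := by
  rw [satOp_last, outflowLayer_of_le (j := N + 1) (m := 1) (by omega),
    outflowLayer_of_le (j := N + 2) (m := 0) (by omega), outflowLayer_last]
  have h0 := stencilRoot_pos
  set κ := stencilRoot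
  have : 18 + 8 * κ ≠ 0 := by positivity
  field_simp
  ring

lemma abs_outflowLayer_of_le {N j m : ℕ} (h : j + m = N + 2) :
    |outflowLayer N j| ≤ (1 / 2) ^ m := by
  have h0 := stencilRoot_pos
  have h1 := stencilRoot_lt
  rw [outflowLayer_of_le h, abs_div, abs_of_pos (by positivity : 0 < 18 + 8 * stencilRoot),
    abs_pow, abs_mul, abs_of_pos h0]
  norm_num
  rw [div_le_iff₀ (by positivity)]
  have : (2 * stencilRoot) ^ m ≤ (1 / 2) ^ m := pow_le_pow_left₀ (by positivity) (by linarith) m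
  have : (0 : ℝ) < (1 / 2) ^ m := by positivity
  nlinarith

lemma abs_outflowLayer_last (N : ℕ) : |outflowLayer N (N + 3)| ≤ 1 := by
  have h0 := stencilRoot_pos
  have h1 := stencilRoot_lt
  rw [outflowLayer_last]
  have : 0 ≤ (4 * stencilRoot + 9) / (18 + 8 * stencilRoot) := by positivity
  have : (4 * stencilRoot + 9) / (18 + 8 * stencilRoot) ≤ 1 := by
    rw [div_le_one (by positivity)]; linarith
  rw [abs_le]; constructor <;> linarith

lemma abs_outflowLayer_le (N j : ℕ) : |outflowLayer N j| ≤ 1 := by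
  by_cases h : j ≤ N + 2
  · obtain ⟨m, hm⟩ := Nat.exists_eq_add_of_le h
    exact (abs_outflowLayer_of_le hm.symm).trans (pow_le_one₀ (by norm_num) (by norm_num))
  · have : outflowLayer N j = outflowLayer N (N + 3) := by simp [outflowLayer, h]
    rw [this]; exact abs_outflowLayer_last N

lemma sum_outflowLayer_sq_le (N : ℕ) :
    ∑ i ∈ Finset.range (N + 4), outflowLayer N i ^ 2 ≤ 3 := by
  rw [Finset.sum_range_succ]
  have h1 : outflowLayer N (N + 3) ^ 2 ≤ 1 :=
    (sq_le_one_iff_abs_le_one _).2 (abs_outflowLayer_le N _)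
  have h2 : ∑ i ∈ Finset.range (N + 3), outflowLayer N i ^ 2 ≤ 2 := by
    rw [← Finset.sum_range_reflect]
    refine le_trans (Finset.sum_le_sum fun i hi => ?_) (sum_half_pow_le (N + 3))
    rw [Finset.mem_range] at hi
    have ha := abs_outflowLayer_of_le (N := N) (j := N + 3 - 1 - i) (m := i) (by omega)
    have hb := abs_outflowLayer_le N (N + 3 - 1 - i)
    rw [← sq_abs]
    nlinarith [abs_nonneg (outflowLayer N (N + 3 - 1 - i))]
  linarith

lemma abs_one_add_inv_le_one {τ : ℝ} (hτ : τ ≤ -1 / 2) : |1 + 1 / τ| ≤ 1 := by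
  have : -2 ≤ 1 / τ := by rw [le_div_iff_of_neg (by linarith)]; linarith
  have : 1 / τ ≤ 0 := div_nonpos_of_nonneg_of_nonpos zero_le_one (by linarith)
  rw [abs_le]; constructor <;> linarith

/-- The term with `1/h` in the bound on `S` counts the nodes that carry the constant part of the
layer. It is absent exactly when `τ = -1`, and this is the only difference between the two upper
bounds. -/
lemma isBoundaryLayer_inflowLayer (N : ℕ) {τ : ℝ} (hτ : τ ≤ -1 / 2) {K S : ℝ} (hK : 10 ≤ K)
    (hS : 4 + 4 * (1 + 1 / τ) ^ 2 / gridSpacing (N + 4) ≤ S) :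
    IsBoundaryLayer N τ K S (1 / 2) (-5 / 26) 0 0 (inflowLayer τ) := by
  have hh := gridSpacing_add_four_pos N
  have hKh : 0 ≤ K * gridSpacing (N + 4) := by positivity
  have hp : (1 / 2 : ℝ) ^ N ≤ K * gridSpacing (N + 4) :=
    (half_pow_le N).trans (mul_le_mul_of_nonneg_right (by linarith) hh.le)
  have hτ' := abs_one_add_inv_le_one hτ
  refine ⟨?_, ?_, fun k hk => satOp_inflowLayer_interior τ hk, ?_, ?_, fun i => ?_, ?_⟩
  · rw [satOp_inflowLayer_zero N (by linarith : τ < 0).ne]; simpa using hKh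
  · rw [satOp_inflowLayer_one]; simpa using hKh
  · rw [sub_zero]; exact (abs_satOp_inflowLayer_penultimate N τ).trans hp
  · rw [sub_zero]; exact (abs_satOp_inflowLayer_last N τ).trans hp
  · exact (abs_inflowLayer_le τ i).trans (by linarith)
  · refine (Finset.sum_le_sum fun i _ => inflowLayer_sq_le τ i).trans ?_
    rw [Finset.sum_add_distrib, Finset.sum_const, Finset.card_range, nsmul_eq_mul,
      ← Finset.mul_sum]
    have h1 := sum_half_pow_le (N + 4)
    have h2 : ((N + 4 : ℕ) : ℝ) ≤ 2 / gridSpacing (N + 4) := by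
      rw [le_div_iff₀ hh]
      push_cast
      have := mul_gridSpacing_eq_one N
      have := gridSpacing_add_four_le_one N
      linarith
    have h3 := mul_le_mul_of_nonneg_right h2 (by positivity : 0 ≤ 2 * (1 + 1 / τ) ^ 2)
    have h4 : 2 / gridSpacing (N + 4) * (2 * (1 + 1 / τ) ^ 2)
        = 4 * (1 + 1 / τ) ^ 2 / gridSpacing (N + 4) := by ring
    linarith

lemma isBoundaryLayer_outflowLayer (N : ℕ) (τ : ℝ) {K S : ℝ} (hK : 10 + 10 * |τ| ≤ K)
    (hS : 3 ≤ S) :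
    IsBoundaryLayer N τ K S 0 0 (1 / 26) (-1 / 10) (outflowLayer N) := by
  have hh := gridSpacing_add_four_pos N
  have hτ0 := abs_nonneg τ
  have hK0 : 0 ≤ K := by linarith
  have hKh : 0 ≤ K * gridSpacing (N + 4) := by positivity
  have hp := half_pow_le N
  have hpos : (0 : ℝ) < (1 / 2) ^ N := by positivity
  have a0 := abs_outflowLayer_of_le (N := N) (j := 0) (m := N + 2) (by omega)
  have a1 := abs_outflowLayer_of_le (N := N) (j := 1) (m := N + 1) (by omega)
  have a2 := abs_outflowLayer_of_le (N := N) (j := 2) (m := N) (by omega)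
  rw [pow_add] at a0 a1
  norm_num at a0 a1 a2
  norm_num at hp hpos
  refine ⟨?_, ?_, fun k hk => satOp_outflowLayer_interior τ hk, ?_, ?_, fun i => ?_, ?_⟩
  · rw [sub_zero, satOp_zero]
    have : |-(1 + 12 / 5 * τ)| ≤ 1 + 12 / 5 * |τ| := by
      rw [abs_neg]
      refine (abs_add_le _ _).trans ?_
      rw [abs_mul]; norm_num
    calc _ ≤ |-(1 + 12 / 5 * τ)| * |outflowLayer N 0| + |outflowLayer N 1| := by
          rw [← abs_mul]; exact abs_add_le _ _
      _ ≤ (1 + 12 / 5 * |τ|) * ((1 / 2) ^ N * (1 / 4)) + (1 / 2) ^ N * (1 / 2) := by gcongr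
      _ = (3 / 4 + 3 / 5 * |τ|) * (1 / 2) ^ N := by ring
      _ ≤ (3 / 4 + 3 / 5 * |τ|) * (3 * gridSpacing (N + 4)) := by gcongr
      _ = (9 / 4 + 9 / 5 * |τ|) * gridSpacing (N + 4) := by ring
      _ ≤ _ := mul_le_mul_of_nonneg_right (by linarith) hh.le
  · rw [sub_zero, satOp_one]
    have : |(-9 * outflowLayer N 0 + 5 * outflowLayer N 1 + 4 * outflowLayer N 2) / 13|
        ≤ (1 / 2) ^ N := by
      rw [abs_le] at *
      constructor <;> linarith
    exact (this.trans hp).trans (mul_le_mul_of_nonneg_right (by linarith) hh.le)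
  · rw [satOp_outflowLayer_penultimate]; simpa using hKh
  · rw [satOp_outflowLayer_last]; simpa using hKh
  · exact (abs_outflowLayer_le N i).trans (by linarith)
  · exact (sum_outflowLayer_sq_le N).trans hS

/-! ### Lower bounds: testing in time and the first row -/

/-- Testing `F' = ρ + a`, `F(0) = 0`, against `T - t`. -/
lemma mul_sq_div_two_le_integral {T a p₀ p₁ : ℝ} {F ρ Q : ℝ → ℝ} (hT : 0 ≤ T) (hF0 : F 0 = 0)
    (hF : ∀ t ∈ Icc 0 T, HasDerivWithinAt F (ρ t + a) (Icc 0 T) t)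
    (hQ : ContinuousOn Q (Icc 0 T))
    (hb : ∀ t ∈ Icc 0 T, |F t| + T * |ρ t| ≤ p₀ + p₁ * Q t) :
    a * T ^ 2 / 2 ≤ T * p₀ + p₁ * ∫ t in (0 : ℝ)..T, Q t := by
  set J : ℝ → ℝ := fun t => -((T - t) * F t + a * (T - t) ^ 2 / 2) with hJ
  have hder : ∀ t ∈ Icc 0 T, HasDerivWithinAt J (F t - (T - t) * ρ t) (Icc 0 T) t := by
    intro t ht
    have h1 : HasDerivWithinAt (fun t => T - t) (-1) (Icc 0 T) t :=
      ((hasDerivAt_id t).const_sub T).hasDerivWithinAt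
    refine ((h1.mul (hF t ht)).add (((h1.pow 2).const_mul a).div_const 2)).neg.congr_deriv ?_
    push_cast; ring
  have hQi : IntervalIntegrable Q MeasureTheory.volume 0 T :=
    ContinuousOn.intervalIntegrable (by rwa [uIcc_of_le hT])
  -- `J` is an antiderivative of `F - (T - t) ρ` with `J T - J 0 = a T² / 2`. The inequality form of
  -- the fundamental theorem needs integrability of the majorant only.
  have key := intervalIntegral.sub_le_integral_of_hasDeriv_right_of_le hT
    (g := J) (g' := fun t => F t - (T - t) * ρ t) (φ := fun t => p₀ + p₁ * Q t)
    (fun t ht => (hder t ht).continuousWithinAt)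
    (fun t ht => (hder t (Ioo_subset_Icc_self ht)).mono_of_mem_nhdsWithin
      (mem_nhdsWithin_of_mem_nhds (Icc_mem_nhds ht.1 ht.2)))
    ((continuousOn_const.add (continuousOn_const.mul hQ)).integrableOn_Icc)
    (fun t ht => by
      have ht' := Ioo_subset_Icc_self ht
      have h1 := hb t ht'
      have h2 : (T - t) * -ρ t ≤ T * |ρ t| :=
        (mul_le_mul_of_nonneg_left (neg_le_abs _) (by linarith [ht'.2])).trans
          (mul_le_mul_of_nonneg_right (by linarith [ht'.1]) (abs_nonneg _))
      have h3 := le_abs_self (F t)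
      linarith)
  rw [intervalIntegral.integral_add intervalIntegrable_const (hQi.const_mul p₁),
    intervalIntegral.integral_const, intervalIntegral.integral_const_mul] at key
  simp only [hJ, hF0, smul_eq_mul] at key
  linarith

lemma abs_mul_sq_div_two_le_integral {T a p₀ p₁ : ℝ} {F ρ Q : ℝ → ℝ} (hT : 0 ≤ T)
    (hF0 : F 0 = 0) (hF : ∀ t ∈ Icc 0 T, HasDerivWithinAt F (ρ t + a) (Icc 0 T) t)
    (hQ : ContinuousOn Q (Icc 0 T))
    (hb : ∀ t ∈ Icc 0 T, |F t| + T * |ρ t| ≤ p₀ + p₁ * Q t) :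
    |a| * T ^ 2 / 2 ≤ T * p₀ + p₁ * ∫ t in (0 : ℝ)..T, Q t := by
  rcases abs_cases a with ⟨h, -⟩ | ⟨h, -⟩ <;> rw [h]
  · exact mul_sq_div_two_le_integral hT hF0 hF hQ hb
  · refine mul_sq_div_two_le_integral (F := fun t => -F t) (ρ := fun t => -ρ t) hT (by simp [hF0])
      (fun t ht => (hF t ht).neg.congr_deriv (by ring)) hQ (fun t ht => ?_)
    simpa using hb t ht

section Quadratic
variable (N : ℕ) (t : ℝ)

/-- For a quadratic profile the second-order expansion is exact. Hence the forcing is constant in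
time and proportional to `h` without remainder. -/
lemma truncationError_sq_zero :
    truncationError N (fun s => s ^ 2) (fun s => 2 * s) t 0 = gridSpacing (N + 4) := by
  have hh := (gridSpacing_add_four_pos N).ne'
  rw [truncationError, satOp_zero]; push_cast; field_simp; ring

lemma truncationError_sq_one :
    truncationError N (fun s => s ^ 2) (fun s => 2 * s) t 1 = -5 / 13 * gridSpacing (N + 4) := by
  have hh := (gridSpacing_add_four_pos N).ne'
  rw [truncationError, satOp_one]; push_cast; field_simp; ring

lemma truncationError_sq_interior {k : ℕ} (hk : k < N) :
    truncationError N (fun s => s ^ 2) (fun s => 2 * s) t (k + 2) = 0 := by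
  have hh := (gridSpacing_add_four_pos N).ne'
  rw [truncationError, satOp_interior _ _ _ hk]; push_cast; field_simp; ring

lemma truncationError_sq_penultimate :
    truncationError N (fun s => s ^ 2) (fun s => 2 * s) t (N + 2)
      = 1 / 13 * gridSpacing (N + 4) := by
  have hh := (gridSpacing_add_four_pos N).ne'
  rw [truncationError, satOp_penultimate]; push_cast; field_simp; ring

lemma truncationError_sq_last :
    truncationError N (fun s => s ^ 2) (fun s => 2 * s) t (N + 3)
      = -1 / 5 * gridSpacing (N + 4) := by
  have hh := (gridSpacing_add_four_pos N).ne'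
  rw [truncationError, satOp_last]; push_cast; field_simp; ring

end Quadratic

/-- Young's inequality with a free scale; it replaces Cauchy–Schwarz in space and time once `s` is a
suitable multiple of `h²`. -/
lemma abs_le_add_sq_div {x s : ℝ} (hs : 0 < s) : |x| ≤ s / 2 + x ^ 2 / (2 * s) := by
  have : s / 2 + x ^ 2 / (2 * s) - |x| = (s - |x|) ^ 2 / (2 * s) := by
    rw [← sq_abs x]; field_simp; ring
  have : 0 ≤ (s - |x|) ^ 2 / (2 * s) := by positivity
  linarith

section Lower
variable {N : ℕ} {τ T : ℝ} {e : ℝ → ℕ → ℝ}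

lemma SolvesForced.continuousOn_sum_sq {R : ℝ → ℕ → ℝ} (he : SolvesForced N τ T e R) :
    ContinuousOn (fun t => gridSpacing (N + 4) * ∑ i ∈ Finset.range (N + 4), e t i ^ 2)
      (Icc 0 T) :=
  continuousOn_const.mul
    (continuousOn_finsetSum _ fun _ hi => (he.continuousOn (Finset.mem_range.1 hi)).pow 2)

/-- The forcing in the first row alone makes the squared error at least of order `h⁵`. -/
lemma pow_five_le_integral (hT : 0 < T)
    (he : SolvesForced N τ T e (truncationError N (fun s => s ^ 2) fun s => 2 * s))
    (he0 : ∀ i < N + 4, e 0 i = 0) :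
    T ^ 3 / (16 * (1 + T * (2 + 3 * |τ|)) ^ 2) * gridSpacing (N + 4) ^ 5
      ≤ ∫ t in (0 : ℝ)..T,
        gridSpacing (N + 4) * ∑ i ∈ Finset.range (N + 4), e t i ^ 2 := by
  have hh := gridSpacing_add_four_pos N
  have hh1 := gridSpacing_add_four_le_one N
  have hc := he.continuousOn_sum_sq
  have hF := he 0 (by omega)
  simp only [truncationError_sq_zero, satOp_zero] at hF
  set h := gridSpacing (N + 4)
  set C := 1 + T * (2 + 3 * |τ|) with hC
  have hτ0 := abs_nonneg τ
  have hC0 : 0 < C := by positivity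
  -- Chosen so that the constant part `T p₀` is half of the left side `h T² / 2`; the other half
  -- must come from the integral.
  set s := T * h ^ 2 / (4 * C) with hs
  have hs0 : 0 < s := by positivity
  have key := mul_sq_div_two_le_integral (a := h) (F := fun t => e t 0)
    (ρ := fun t => -h⁻¹ * (-(1 + 12 / 5 * τ) * e t 0 + e t 1))
    (Q := fun t => h * ∑ i ∈ Finset.range (N + 4), e t i ^ 2)
    (p₀ := C * h⁻¹ * s) (p₁ := C * h⁻¹ * (h⁻¹ / s)) hT.le (he0 0 (by omega)) hF hc (fun t ht => by
      have h1 : |-h⁻¹ * (-(1 + 12 / 5 * τ) * e t 0 + e t 1)|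
          ≤ h⁻¹ * ((2 + 3 * |τ|) * (|e t 0| + |e t 1|)) := by
        rw [abs_mul, abs_neg, abs_of_pos (inv_pos.2 hh)]
        refine mul_le_mul_of_nonneg_left ?_ (inv_pos.2 hh).le
        refine (abs_add_le _ _).trans ?_
        rw [abs_mul, abs_neg]
        have : |1 + 12 / 5 * τ| ≤ 1 + 12 / 5 * |τ| := by
          refine (abs_add_le _ _).trans ?_
          rw [abs_mul]; norm_num
        have := mul_le_mul_of_nonneg_right this (abs_nonneg (e t 0))
        nlinarith [abs_nonneg (e t 0), abs_nonneg (e t 1)]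
      have h2 : |e t 0| ≤ h⁻¹ * (|e t 0| + |e t 1|) := by
        have : 1 ≤ h⁻¹ := (one_le_inv₀ hh).2 hh1
        nlinarith [abs_nonneg (e t 0), abs_nonneg (e t 1)]
      have h3 : |e t 0| + |e t 1| ≤ s + (∑ i ∈ Finset.range (N + 4), e t i ^ 2) / s := by
        have a0 := abs_le_add_sq_div (x := e t 0) hs0
        have a1 := abs_le_add_sq_div (x := e t 1) hs0
        have : e t 0 ^ 2 + e t 1 ^ 2 ≤ ∑ i ∈ Finset.range (N + 4), e t i ^ 2 := by
          rw [sum_range_add_four]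
          have : 0 ≤ ∑ k ∈ Finset.range N, e t (k + 2) ^ 2 :=
            Finset.sum_nonneg fun _ _ => sq_nonneg _
          linarith [sq_nonneg (e t (N + 2)), sq_nonneg (e t (N + 3))]
        have := div_le_div_of_nonneg_right this hs0.le
        have p : 0 ≤ (e t 0 ^ 2 + e t 1 ^ 2) / s := by positivity
        have q : e t 0 ^ 2 / (2 * s) + e t 1 ^ 2 / (2 * s) = (e t 0 ^ 2 + e t 1 ^ 2) / s / 2 := by
          field_simp
        linarith
      calc |e t 0| + T * |-h⁻¹ * (-(1 + 12 / 5 * τ) * e t 0 + e t 1)|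
          ≤ h⁻¹ * (|e t 0| + |e t 1|)
            + T * (h⁻¹ * ((2 + 3 * |τ|) * (|e t 0| + |e t 1|))) := by gcongr
        _ = C * h⁻¹ * (|e t 0| + |e t 1|) := by rw [hC]; ring
        _ ≤ C * h⁻¹ * (s + (∑ i ∈ Finset.range (N + 4), e t i ^ 2) / s) := by gcongr
        _ = _ := by field_simp)
  set I := ∫ t in (0 : ℝ)..T, h * ∑ i ∈ Finset.range (N + 4), e t i ^ 2
  have e1 : T * (C * h⁻¹ * s) = h * T ^ 2 / 4 := by rw [hs]; field_simp
  have e2 : C * h⁻¹ * (h⁻¹ / s) * I = 4 * C ^ 2 * I / (T * h ^ 4) := by rw [hs]; field_simp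
  rw [e1, e2] at key
  have h4 : h * T ^ 2 / 4 ≤ 4 * C ^ 2 * I / (T * h ^ 4) := by linarith
  rw [le_div_iff₀ (by positivity)] at h4
  rw [div_mul_eq_mul_div, div_le_iff₀ (by positivity)]
  linarith

end Lower

/-! ### Lower bound for `τ ≠ -1` by duality -/

/-- The boundary layer of the adjoint problem at the inflow. -/
def dualLayer (τ : ℝ) : ℕ → ℝ
  | 0 => -(1 / τ)
  | j + 1 => 1 + 5 * (1 + 1 / τ) / (9 + 4 * stencilRoot) * (-2 * stencilRoot) ^ j

section Dual
variable {τ : ℝ}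

/-- The interior columns do not involve the value at node 0, so the two inflow columns determine
that value and the coefficient of `(-2κ) ^ j`. For `τ = -1` this coefficient vanishes and the dual
layer is the constant `1`. -/
lemma dualLayer_column_zero (hτ : τ ≠ 0) :
    -(5 + 12 * τ) * dualLayer τ 0 - 9 * dualLayer τ 1 + 2 * dualLayer τ 2 = 0 := by
  have h0 := stencilRoot_pos
  have : 9 + 4 * stencilRoot ≠ 0 := by positivity
  simp only [dualLayer]
  field_simp
  ring

lemma dualLayer_column_one (hτ : τ ≠ 0) :
    5 * dualLayer τ 0 + 5 * dualLayer τ 1 - 12 * dualLayer τ 2 + 2 * dualLayer τ 3 = 0 := by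
  have h0 := stencilRoot_pos
  have e := stencilRoot_eq
  have : 9 + 4 * stencilRoot ≠ 0 := by positivity
  simp only [dualLayer]
  field_simp
  linear_combination 20 * (1 + τ) * e

lemma dualLayer_column_interior (τ : ℝ) (k : ℕ) :
    dualLayer τ (k + 1) / 3 + dualLayer τ (k + 2) / 2 - dualLayer τ (k + 3)
      + dualLayer τ (k + 4) / 6 = 0 := by
  have e := stencilRoot_eq
  simp only [dualLayer]
  set κ := stencilRoot
  set γ := 5 * (1 + 1 / τ) / (9 + 4 * κ)
  have : (1 + γ * (-2 * κ) ^ k) / 3 + (1 + γ * (-2 * κ) ^ (k + 1)) / 2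
      - (1 + γ * (-2 * κ) ^ (k + 2)) + (1 + γ * (-2 * κ) ^ (k + 3)) / 6
      = γ * (-2 * κ) ^ k * (-2 * κ - 1) * (2 * κ ^ 2 + 5 * κ - 1) / 3 := by ring
  rw [this, e]; simp

lemma abs_dualLayer_le (hτ : τ ≤ -1 / 2) (j : ℕ) : |dualLayer τ j| ≤ 2 := by
  have h0 := stencilRoot_pos
  have h1 := stencilRoot_lt
  have hδ := abs_one_add_inv_le_one hτ
  rcases j with _ | j
  · rw [dualLayer]
    rw [abs_le] at *; constructor <;> linarith
  · rw [dualLayer]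
    refine (abs_add_le _ _).trans ?_
    have h2 : |5 * (1 + 1 / τ) / (9 + 4 * stencilRoot)| ≤ 1 := by
      rw [abs_div, abs_mul, abs_of_pos (by positivity : 0 < 9 + 4 * stencilRoot),
        div_le_one (by positivity)]
      norm_num at hδ ⊢; linarith
    have h3 : |(-2 * stencilRoot) ^ j| ≤ 1 := by
      rw [abs_pow]
      refine pow_le_one₀ (abs_nonneg _) ?_
      rw [abs_le]; constructor <;> linarith
    rw [abs_mul, abs_one]
    have := mul_le_mul h2 h3 (abs_nonneg _) zero_le_one
    linarith

/-- This jump is what the inflow forcing sees: the weighted truncation errors `5/12 · 1` and `13/12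
· (-5/13)` are opposite, so a constant test vector would not detect them. -/
lemma abs_le_dualLayer_sub (τ : ℝ) :
    |1 + 1 / τ| ≤ |dualLayer τ 0 - dualLayer τ 1| := by
  have h0 := stencilRoot_pos
  have : dualLayer τ 0 - dualLayer τ 1
      = -((1 + 1 / τ) * (1 + 5 / (9 + 4 * stencilRoot))) := by
    simp only [dualLayer]; ring
  rw [this, abs_neg, abs_mul]
  refine le_mul_of_one_le_right (abs_nonneg _) ?_
  have : 0 < 5 / (9 + 4 * stencilRoot) := by positivity
  rw [abs_of_pos (by positivity)]; linarith

/-- The adjoint test function: the dual boundary layer damped quadratically at the outflow. -/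
def dualWeight (N : ℕ) (τ : ℝ) (i : ℕ) : ℝ :=
  dualLayer τ i * (1 - i * gridSpacing (N + 4)) ^ 2

variable {N : ℕ}

lemma abs_dualWeight_le (hτ : τ ≤ -1 / 2) {i : ℕ} (hi : i < N + 4) : |dualWeight N τ i| ≤ 2 := by
  have h := gridPoint_mem_Icc hi
  rw [dualWeight, abs_mul]
  have : |(1 - (i : ℝ) * gridSpacing (N + 4)) ^ 2| ≤ 1 := by
    rw [abs_of_nonneg (sq_nonneg _), sq_le_one_iff_abs_le_one, abs_le]
    constructor <;> linarith [h.1, h.2]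
  calc _ ≤ (2 : ℝ) * 1 := mul_le_mul (abs_dualLayer_le hτ i) this (abs_nonneg _) (by norm_num)
    _ = 2 := mul_one _

/-- The quadratic factor varies by `O(h)` across a stencil. Freezing it at node `i` lets the exact
column identities of `dualLayer` apply, with `r` as the error. -/
lemma dualWeight_eq (hτ : τ ≤ -1 / 2) {i j : ℕ} (hi : i < N + 4) (hj : j < N + 4) {m : ℝ}
    (hm : |(j : ℝ) - i| ≤ m) :
    ∃ r, |r| ≤ 4 * m * gridSpacing (N + 4) ∧
      dualWeight N τ j = dualLayer τ j * (1 - i * gridSpacing (N + 4)) ^ 2 + r := by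
  have h1 := gridPoint_mem_Icc hi
  have h2 := gridPoint_mem_Icc hj
  have hh := gridSpacing_add_four_pos N
  set h := gridSpacing (N + 4)
  refine ⟨dualLayer τ j * ((((j : ℝ) - i) * h) * ((i * h - 1) + (j * h - 1))), ?_, by
    rw [dualWeight]; ring⟩
  rw [abs_mul, abs_mul, abs_mul, abs_of_pos hh]
  have h3 : |(i * h - 1) + (j * h - 1)| ≤ 2 := by
    rw [abs_le]; constructor <;> linarith [h1.1, h1.2, h2.1, h2.2]
  have hm0 := (abs_nonneg _).trans hm
  calc _ ≤ 2 * (m * h * 2) := mul_le_mul (abs_dualLayer_le hτ j) (by gcongr) (by positivity)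
        (by norm_num)
    _ = _ := by ring

/-- Every adjoint column applied to `dualWeight` is `O(h)`. At the outflow this is due to the
quadratic factor: a constant would give `1` in the last column. -/
lemma abs_sum_dualWeight_mul_satOp_le (hτ : τ ≤ -1 / 2) (v : ℕ → ℝ) :
    |∑ i ∈ Finset.range (N + 4), sbpWeight N i * dualWeight N τ i * satOp N τ v i|
      ≤ 8 * gridSpacing (N + 4) * ∑ i ∈ Finset.range (N + 4), |v i| := by
  have hh := gridSpacing_add_four_pos N
  have hh1 := gridSpacing_add_four_le_one N
  have hNh := mul_gridSpacing_eq_one N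
  have hτ0 : τ ≠ 0 := by linarith
  rw [sum_mul_satOp_eq_adjoint]
  set y := dualWeight N τ with hy
  have c0 : |(-(5 + 12 * τ) * y 0 - 9 * y 1 + 2 * y 2) / 12| ≤ 8 * gridSpacing (N + 4) := by
    obtain ⟨r1, b1, e1⟩ := dualWeight_eq (N := N) hτ (i := 0) (j := 1) (m := 1) (by omega)
      (by omega) (by norm_num)
    obtain ⟨r2, b2, e2⟩ := dualWeight_eq (N := N) hτ (i := 0) (j := 2) (m := 2) (by omega)
      (by omega) (by norm_num)
    have e0 : y 0 = dualLayer τ 0 := by simp [hy, dualWeight]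
    rw [hy, e1, e2, ← hy, e0]
    have := dualLayer_column_zero hτ0
    have : (-(5 + 12 * τ) * dualLayer τ 0
        - 9 * (dualLayer τ 1 * (1 - (0 : ℕ) * gridSpacing (N + 4)) ^ 2 + r1)
        + 2 * (dualLayer τ 2 * (1 - (0 : ℕ) * gridSpacing (N + 4)) ^ 2 + r2)) / 12
        = (-9 * r1 + 2 * r2) / 12 := by
      push_cast; linear_combination this / 12
    rw [this]
    rw [abs_le] at *; constructor <;> linarith
  have c1 : |(5 * y 0 + 5 * y 1 - 12 * y 2 + 2 * y 3) / 12| ≤ 8 * gridSpacing (N + 4) := by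
    obtain ⟨r0, b0, e0⟩ := dualWeight_eq (N := N) hτ (i := 1) (j := 0) (m := 1) (by omega)
      (by omega) (by norm_num)
    obtain ⟨r2, b2, e2⟩ := dualWeight_eq (N := N) hτ (i := 1) (j := 2) (m := 1) (by omega)
      (by omega) (by norm_num)
    obtain ⟨r3, b3, e3⟩ := dualWeight_eq (N := N) hτ (i := 1) (j := 3) (m := 2) (by omega)
      (by omega) (by norm_num)
    have e1 : dualWeight N τ 1 = dualLayer τ 1 * (1 - (1 : ℕ) * gridSpacing (N + 4)) ^ 2 := rfl
    rw [hy, e0, e1, e2, e3]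
    set θ := (1 - ((1 : ℕ) : ℝ) * gridSpacing (N + 4)) ^ 2
    have := dualLayer_column_one hτ0
    have : (5 * (dualLayer τ 0 * θ + r0) + 5 * (dualLayer τ 1 * θ)
        - 12 * (dualLayer τ 2 * θ + r2) + 2 * (dualLayer τ 3 * θ + r3)) / 12
        = (5 * r0 - 12 * r2 + 2 * r3) / 12 := by
      linear_combination θ / 12 * this
    rw [this]
    rw [abs_le] at *; constructor <;> linarith
  have ci : ∀ k < N, |y (k + 1) / 3 + y (k + 2) / 2 - y (k + 3) + y (k + 4) / 6|
      ≤ 8 * gridSpacing (N + 4) := by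
    intro k hk
    obtain ⟨r1, b1, e1⟩ := dualWeight_eq (N := N) hτ (i := k + 2) (j := k + 1) (m := 1) (by omega)
      (by omega) (by push_cast; norm_num)
    obtain ⟨r3, b3, e3⟩ := dualWeight_eq (N := N) hτ (i := k + 2) (j := k + 3) (m := 1) (by omega)
      (by omega) (by push_cast; norm_num)
    obtain ⟨r4, b4, e4⟩ := dualWeight_eq (N := N) hτ (i := k + 2) (j := k + 4) (m := 2) (by omega)
      (by omega) (by push_cast; norm_num)
    have e2 : dualWeight N τ (k + 2)
      = dualLayer τ (k + 2) * (1 - (k + 2 : ℕ) * gridSpacing (N + 4)) ^ 2 := rfl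
    rw [hy, e1, e2, e3, e4]
    set θ := (1 - ((k + 2 : ℕ) : ℝ) * gridSpacing (N + 4)) ^ 2
    have := dualLayer_column_interior τ k
    have : (dualLayer τ (k + 1) * θ + r1) / 3 + dualLayer τ (k + 2) * θ / 2
        - (dualLayer τ (k + 3) * θ + r3) + (dualLayer τ (k + 4) * θ + r4) / 6
        = r1 / 3 - r3 + r4 / 6 := by
      linear_combination θ * this
    rw [this]
    rw [abs_le] at *; constructor <;> linarith
  have y3 : y (N + 3) = 0 := by
    have : (1 - ((N + 3 : ℕ) : ℝ) * gridSpacing (N + 4)) = 0 := by push_cast; linarith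
    rw [hy, dualWeight, this]; simp
  have y2 : |y (N + 2)| ≤ 2 * gridSpacing (N + 4) := by
    have : (1 - ((N + 2 : ℕ) : ℝ) * gridSpacing (N + 4)) = gridSpacing (N + 4) := by
      push_cast; linarith
    rw [hy, dualWeight, this, abs_mul, abs_of_nonneg (sq_nonneg (gridSpacing (N + 4)))]
    exact mul_le_mul (abs_dualLayer_le hτ _) (by nlinarith) (sq_nonneg _) (by norm_num)
  have y1 : |y (N + 1)| ≤ 16 * gridSpacing (N + 4) := by
    obtain ⟨r, b, er⟩ := dualWeight_eq (N := N) hτ (i := N + 3) (j := N + 1) (m := 2) (by omega)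
      (by omega) (by push_cast; norm_num)
    have : (1 - ((N + 3 : ℕ) : ℝ) * gridSpacing (N + 4)) = 0 := by push_cast; linarith
    rw [hy, er, this]
    norm_num
    linarith
  have c2 : |(4 * y (N + 1) + 5 * y (N + 2) - 9 * y (N + 3)) / 12|
      ≤ 8 * gridSpacing (N + 4) := by
    rw [y3]
    rw [abs_le] at *; constructor <;> linarith
  have c3 : |(5 * y (N + 2) + 7 * y (N + 3)) / 12| ≤ 8 * gridSpacing (N + 4) := by
    rw [y3]
    rw [abs_le] at *; constructor <;> linarith
  have term : ∀ {a c : ℝ}, |c| ≤ 8 * gridSpacing (N + 4) →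
      |a * c| ≤ 8 * gridSpacing (N + 4) * |a| := fun {a c} hc => by
    rw [abs_mul, mul_comm]; exact mul_le_mul_of_nonneg_right hc (abs_nonneg a)
  rw [sum_range_add_four, mul_add, mul_add, mul_add, mul_add]
  refine (abs_add_le _ _).trans (add_le_add ((abs_add_le _ _).trans (add_le_add
    ((abs_add_le _ _).trans (add_le_add ((abs_add_le _ _).trans (add_le_add (term c0) (term c1)))
      ?_)) (term c2))) (term c3))
  rw [Finset.mul_sum]
  exact (Finset.abs_sum_le_sum_abs _ _).trans
    (Finset.sum_le_sum fun k hk => term (ci k (Finset.mem_range.1 hk)))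

/-- If `τ ≠ -1` the squared error is at least of order `h⁴`. -/
lemma pow_four_le_integral {T : ℝ} {e : ℝ → ℕ → ℝ} (hT : 0 < T) (hτ : τ ≤ -1 / 2) (hτ1 : τ ≠ -1)
    (hN : 24 * gridSpacing (N + 4) ≤ |1 + 1 / τ|)
    (he : SolvesForced N τ T e (truncationError N (fun s => s ^ 2) fun s => 2 * s))
    (he0 : ∀ i < N + 4, e 0 i = 0) :
    |1 + 1 / τ| ^ 2 * T ^ 3 / (288 * (3 + 8 * T) ^ 2) * gridSpacing (N + 4) ^ 4
      ≤ ∫ t in (0 : ℝ)..T,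
        gridSpacing (N + 4) * ∑ i ∈ Finset.range (N + 4), e t i ^ 2 := by
  have hh := gridSpacing_add_four_pos N
  have hh1 := gridSpacing_add_four_le_one N
  have hNh := mul_gridSpacing_eq_one N
  have hc := he.continuousOn_sum_sq
  have hsat := fun t => abs_sum_dualWeight_mul_satOp_le (N := N) hτ (e t)
  have hδ : 0 < |1 + 1 / τ| := by
    rw [abs_pos]
    intro h0
    have hτ0 : τ ≠ 0 := by linarith
    field_simp at h0
    exact hτ1 (by linarith)
  have hδ1 := abs_le_dualLayer_sub τ
  have hy := fun i (hi : i < N + 4) => abs_dualWeight_le (N := N) hτ hi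
  -- The weight vanishes at the last node and is `O(h²)` next to it, so outflow forcing contributes
  -- only the small second term.
  have hsum : ∀ t, ∑ i ∈ Finset.range (N + 4), sbpWeight N i * dualWeight N τ i
      * truncationError N (fun s => s ^ 2) (fun s => 2 * s) t i
      = gridSpacing (N + 4) * (5 / 12 * (dualLayer τ 0 - dualLayer τ 1
          * (1 - gridSpacing (N + 4)) ^ 2)
        + dualLayer τ (N + 2) * gridSpacing (N + 4) ^ 2 / 12) := by
    intro t
    rw [sum_range_add_four, Finset.sum_eq_zero fun k hk => by
      rw [truncationError_sq_interior _ _ (Finset.mem_range.1 hk), mul_zero],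
      truncationError_sq_zero, truncationError_sq_one, truncationError_sq_penultimate,
      truncationError_sq_last, sbpWeight_zero, sbpWeight_one, sbpWeight_penultimate,
      sbpWeight_last]
    have h3 : dualWeight N τ (N + 3) = 0 := by
      have : (1 - ((N + 3 : ℕ) : ℝ) * gridSpacing (N + 4)) = 0 := by push_cast; linarith
      rw [dualWeight, this]; simp
    have h2 : dualWeight N τ (N + 2) = dualLayer τ (N + 2) * gridSpacing (N + 4) ^ 2 := by
      have : (1 - ((N + 2 : ℕ) : ℝ) * gridSpacing (N + 4)) = gridSpacing (N + 4) := by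
        push_cast; linarith
      rw [dualWeight, this]
    rw [h3, h2, dualWeight, dualWeight]
    push_cast
    ring
  set h := gridSpacing (N + 4)
  set A := 5 / 12 * (dualLayer τ 0 - dualLayer τ 1 * (1 - h) ^ 2)
    + dualLayer τ (N + 2) * h ^ 2 / 12 with hA
  set δ := |1 + 1 / τ| with hδdef
  -- The jump contributes `5δ/12` and the perturbation is at most `2h`, which `24 h ≤ δ` bounds by
  -- `δ/12`.
  have hAδ : δ / 3 ≤ |A| := by
    have d1 := abs_dualLayer_le hτ 1
    have d2 := abs_dualLayer_le hτ (N + 2)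
    have e1 : A = 5 / 12 * (dualLayer τ 0 - dualLayer τ 1)
        + (5 / 12 * (dualLayer τ 1 * (h * (2 - h))) + dualLayer τ (N + 2) * h ^ 2 / 12) := by
      rw [hA]; ring
    have e2 : |5 / 12 * (dualLayer τ 1 * (h * (2 - h))) + dualLayer τ (N + 2) * h ^ 2 / 12|
        ≤ 2 * h := by
      have m1 : |dualLayer τ 1 * (h * (2 - h))| ≤ 2 * (h * 2) := by
        rw [abs_mul, abs_of_nonneg (mul_nonneg hh.le (by linarith : 0 ≤ 2 - h))]
        exact mul_le_mul d1 (by nlinarith) (mul_nonneg hh.le (by linarith)) (by norm_num)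
      have m2 : |dualLayer τ (N + 2) * h ^ 2| ≤ 2 * h := by
        rw [abs_mul, abs_of_nonneg (sq_nonneg h)]
        exact mul_le_mul d2 (by nlinarith) (sq_nonneg _) (by norm_num)
      rw [abs_le] at m1 m2 ⊢; constructor <;> linarith
    have e3 := abs_sub_abs_le_abs_sub (5 / 12 * (dualLayer τ 0 - dualLayer τ 1))
      (-(5 / 12 * (dualLayer τ 1 * (h * (2 - h))) + dualLayer τ (N + 2) * h ^ 2 / 12))
    rw [abs_neg, sub_neg_eq_add, ← e1, abs_mul, abs_of_pos (by norm_num : (0 : ℝ) < 5 / 12)] at e3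
    linarith
  set C := 3 + 8 * T with hC
  have hC0 : 0 < C := by positivity
  -- Chosen so that `T p₀ = δ T² h / 12`, half of the lower bound `δ T² h / 6` for the left side.
  set s := δ * T / (24 * C) * h ^ 2 with hs
  have hs0 : 0 < s := by positivity
  have key := abs_mul_sq_div_two_le_integral (a := h * A)
    (F := fun t => ∑ i ∈ Finset.range (N + 4), sbpWeight N i * dualWeight N τ i * e t i)
    (ρ := fun t => -h⁻¹ * ∑ i ∈ Finset.range (N + 4),
      sbpWeight N i * dualWeight N τ i * satOp N τ (e t) i)
    (Q := fun t => h * ∑ i ∈ Finset.range (N + 4), e t i ^ 2)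
    (p₀ := C * (2 * s / h)) (p₁ := C * (h⁻¹ / s)) hT.le
    (Finset.sum_eq_zero fun i hi => by rw [he0 i (Finset.mem_range.1 hi), mul_zero])
    (fun t ht => by
      rw [← hsum t, Finset.mul_sum, ← Finset.sum_add_distrib]
      refine HasDerivWithinAt.fun_sum fun i hi => ?_
      refine ((he i (Finset.mem_range.1 hi) t ht).const_mul _).congr_deriv ?_
      ring) hc (fun t ht => by
      have h1 : |∑ i ∈ Finset.range (N + 4), sbpWeight N i * dualWeight N τ i * e t i|
          ≤ 3 * ∑ i ∈ Finset.range (N + 4), |e t i| := by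
        rw [Finset.mul_sum]
        refine (Finset.abs_sum_le_sum_abs _ _).trans (Finset.sum_le_sum fun i hi => ?_)
        rw [abs_mul, abs_mul, abs_of_pos (sbpWeight_pos N i)]
        refine mul_le_mul_of_nonneg_right ?_ (abs_nonneg _)
        have := mul_le_mul (sbpWeight_le N i) (hy i (Finset.mem_range.1 hi)) (abs_nonneg _)
          (by norm_num)
        linarith
      have h2 : |-h⁻¹ * ∑ i ∈ Finset.range (N + 4),
          sbpWeight N i * dualWeight N τ i * satOp N τ (e t) i|
          ≤ 8 * ∑ i ∈ Finset.range (N + 4), |e t i| := by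
        rw [abs_mul, abs_neg, abs_of_pos (inv_pos.2 hh), inv_mul_le_iff₀ hh]
        linarith [hsat t]
      have h3 : ∑ i ∈ Finset.range (N + 4), |e t i|
          ≤ 2 * s / h + (∑ i ∈ Finset.range (N + 4), e t i ^ 2) / s := by
        have : ∀ i ∈ Finset.range (N + 4), |e t i| ≤ s + e t i ^ 2 / s := fun i _ => by
          have a := abs_le_add_sq_div (x := e t i) hs0
          have b : e t i ^ 2 / (2 * s) = e t i ^ 2 / s / 2 := by field_simp
          have c : 0 ≤ e t i ^ 2 / s := by positivity
          linarith
        refine (Finset.sum_le_sum this).trans ?_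
        rw [Finset.sum_add_distrib, ← Finset.sum_div, Finset.sum_const, Finset.card_range,
          nsmul_eq_mul]
        have : ((N + 4 : ℕ) : ℝ) * s ≤ 2 * s / h := by
          rw [le_div_iff₀ hh]
          push_cast
          nlinarith
        linarith
      calc _ ≤ 3 * ∑ i ∈ Finset.range (N + 4), |e t i|
            + T * (8 * ∑ i ∈ Finset.range (N + 4), |e t i|) := by gcongr
        _ = C * ∑ i ∈ Finset.range (N + 4), |e t i| := by rw [hC]; ring
        _ ≤ C * (2 * s / h + (∑ i ∈ Finset.range (N + 4), e t i ^ 2) / s) := by gcongr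
        _ = _ := by field_simp)
  set I := ∫ t in (0 : ℝ)..T, h * ∑ i ∈ Finset.range (N + 4), e t i ^ 2
  have e1 : T * (C * (2 * s / h)) = δ * T ^ 2 * h / 12 := by rw [hs]; field_simp; ring
  have e2 : C * (h⁻¹ / s) * I = 24 * C ^ 2 * I / (δ * T * h ^ 3) := by rw [hs]; field_simp
  rw [e1, e2, abs_mul, abs_of_pos hh] at key
  have h4 : δ * T ^ 2 * h / 12 ≤ 24 * C ^ 2 * I / (δ * T * h ^ 3) := by
    have := mul_le_mul_of_nonneg_right hAδ (by positivity : 0 ≤ h * T ^ 2 / 2)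
    linarith
  rw [le_div_iff₀ (by positivity)] at h4
  rw [div_mul_eq_mul_div, div_le_iff₀ (by positivity)]
  linarith

end Dual

/-! ### Exact solutions as travelling waves -/

/-- Solutions of the advection equation are constant along characteristics. -/
lemma IsAdvectionSolution.eq_of_sub_eq {m : WithTop ℕ∞} (hm : 1 ≤ m) {T : ℝ} (hT : 0 < T)
    {U : ℝ → ℝ → ℝ} (hU : IsAdvectionSolution m T U) {x t y s : ℝ} (hx : x ∈ Icc (0 : ℝ) 1)
    (ht : t ∈ Icc (0 : ℝ) T) (hy : y ∈ Icc (0 : ℝ) 1) (hs : s ∈ Icc (0 : ℝ) T)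
    (h : x - t = y - s) : U x t = U y s := by
  set c := y - x with hc
  have hc' : s - t = c := by rw [hc]; linarith
  set p : ℝ → ℝ := fun r => U (x + r * c) (t + r * c) with hp
  have hmx : ∀ r ∈ Icc (0 : ℝ) 1, x + r * c ∈ Icc (0 : ℝ) 1 := fun r hr => by
    have := (convex_Icc (0 : ℝ) 1) hx hy (a := 1 - r) (b := r) (by linarith [hr.2]) hr.1 (by ring)
    convert this using 1
    simp only [smul_eq_mul, hc]; ring
  have hmt : ∀ r ∈ Icc (0 : ℝ) 1, t + r * c ∈ Icc (0 : ℝ) T := fun r hr => by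
    have := (convex_Icc (0 : ℝ) T) ht hs (a := 1 - r) (b := r) (by linarith [hr.2]) hr.1 (by ring)
    convert this using 1
    simp only [smul_eq_mul, ← hc']; ring
  have hder : ∀ r ∈ Icc (0 : ℝ) 1, HasDerivWithinAt p 0 (Icc 0 1) r := by
    intro r hr
    have mem : ((x + r * c, t + r * c) : ℝ × ℝ) ∈ Icc (0 : ℝ) 1 ×ˢ Icc (0 : ℝ) T :=
      ⟨hmx r hr, hmt r hr⟩
    have hL := ((hU.smooth.differentiableOn (by
      intro h0; simp [h0] at hm)) _ mem).hasFDerivWithinAt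
    set L := fderivWithin ℝ (Function.uncurry U) (Icc (0 : ℝ) 1 ×ˢ Icc (0 : ℝ) T)
      (x + r * c, t + r * c) with hLdef
    have dx : HasDerivWithinAt (fun z => U z (t + r * c)) (L (1, 0)) (Icc 0 1) (x + r * c) := by
      have hcurve : HasDerivWithinAt (fun z : ℝ => (z, t + r * c)) ((1 : ℝ), (0 : ℝ)) (Icc 0 1)
          (x + r * c) := (hasDerivWithinAt_id _ _).prodMk (hasDerivWithinAt_const _ _ _)
      exact hL.comp_hasDerivWithinAt (x + r * c) hcurve (fun z hz => mk_mem_prod hz (hmt r hr))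
    have dt : HasDerivWithinAt (fun z => U (x + r * c) z) (L (0, 1)) (Icc 0 T) (t + r * c) := by
      have hcurve : HasDerivWithinAt (fun z : ℝ => (x + r * c, z)) ((0 : ℝ), (1 : ℝ)) (Icc 0 T)
          (t + r * c) := (hasDerivWithinAt_const _ _ _).prodMk (hasDerivWithinAt_id _ _)
      exact hL.comp_hasDerivWithinAt (t + r * c) hcurve (fun z hz => mk_mem_prod (hmx r hr) hz)
    have heq := hU.equation _ (hmx r hr) _ (hmt r hr)
    rw [dt.derivWithin (uniqueDiffOn_Icc hT _ (hmt r hr)),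
      dx.derivWithin (uniqueDiffOn_Icc zero_lt_one _ (hmx r hr))] at heq
    have line : ∀ a : ℝ, HasDerivWithinAt (fun r : ℝ => a + r * c) c (Icc 0 1) r := fun a => by
      simpa using (((hasDerivAt_id r).mul_const c).const_add a).hasDerivWithinAt
    have hcomp := hL.comp_hasDerivWithinAt r ((line x).prodMk (line t))
      (fun z hz => mk_mem_prod (hmx z hz) (hmt z hz))
    refine hcomp.congr_deriv ?_
    have : ((c, c) : ℝ × ℝ) = c • (((0 : ℝ), (1 : ℝ)) + ((1 : ℝ), (0 : ℝ))) := by simp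
    rw [this, map_smul, map_add, heq, smul_zero]
  have hconst := constant_of_derivWithin_zero (f := p) (a := 0) (b := 1)
    (fun r hr => (hder r hr).differentiableWithinAt) (fun r hr =>
      (hder r (Ico_subset_Icc_self hr)).derivWithin
        (uniqueDiffOn_Icc zero_lt_one _ (Ico_subset_Icc_self hr))) 1 ⟨zero_le_one, le_rfl⟩
  simp only [hp, hc, one_mul, zero_mul, add_zero] at hconst
  rw [← hconst]
  congr 1 <;> linarith

/-- A `C^k` function on a compact interval extends to a `C^k` function on the line. -/
lemma ContDiffOn.exists_contDiff_extension {a b : ℝ} (hab : a < b) (k : ℕ) :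
    ∀ {f : ℝ → ℝ}, ContDiffOn ℝ k f (Icc a b) → ∃ F : ℝ → ℝ, ContDiff ℝ k F ∧
      EqOn F f (Icc a b) := by
  induction k with
  | zero =>
    intro f hf
    have hc : ContinuousOn f (Icc a b) := hf.continuousOn
    refine ⟨IccExtend hab.le ((Icc a b).domRestrict f), ?_, fun x hx => ?_⟩
    · exact contDiff_zero.2 (continuous_IccExtend_iff.2 hc.domRestrict)
    · rw [IccExtend_of_mem _ _ hx, domRestrict_apply]
  | succ k ih =>
    intro f hf
    push_cast at hf
    rw [contDiffOn_succ_iff_derivWithin (uniqueDiffOn_Icc hab)] at hf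
    -- The derivative is extended first; the primitive of its extension with the value of `f` at `a`
    -- then extends `f`.
    obtain ⟨g, hg, hgf⟩ := ih hf.2.2
    have hF : ∀ x, HasDerivAt (fun x => f a + ∫ t in a..x, g t) (g x) x := fun x =>
      (intervalIntegral.integral_hasDerivAt_right (hg.continuous.intervalIntegrable _ _)
        (hg.continuous.stronglyMeasurableAtFilter _ _) hg.continuous.continuousAt).const_add _
    refine ⟨fun x => f a + ∫ t in a..x, g t, ?_, fun x hx => ?_⟩
    · push_cast
      rw [contDiff_succ_iff_deriv]
      refine ⟨fun x => (hF x).differentiableAt, by simp, ?_⟩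
      rwa [show deriv (fun x => f a + ∫ t in a..x, g t) = g from funext fun x => (hF x).deriv]
    · have hd : ∀ y ∈ Icc a b, HasDerivWithinAt (fun x => f x - (f a + ∫ t in a..x, g t)) 0
          (Icc a b) y := fun y hy => by
        refine ((hf.1 y hy).hasDerivWithinAt.sub (hF y).hasDerivWithinAt).congr_deriv ?_
        rw [hgf hy, sub_self]
      have := constant_of_derivWithin_zero (fun y hy => (hd y hy).differentiableWithinAt)
        (fun y hy => (hd y (Ico_subset_Icc_self hy)).derivWithin
          (uniqueDiffOn_Icc hab _ (Ico_subset_Icc_self hy))) x hx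
      simp only [intervalIntegral.integral_same, add_zero, sub_self] at this
      simp only
      linarith

/-- A solution of the advection equation is a travelling wave with a `C⁴` profile. -/
lemma IsAdvectionSolution.exists_profile {m : WithTop ℕ∞} (hm : 4 ≤ m) {T : ℝ} (hT : 0 < T)
    {U : ℝ → ℝ → ℝ} (hU : IsAdvectionSolution m T U) :
    ∃ G : ℝ → ℝ, ContDiff ℝ 4 G ∧
      ∀ x ∈ Icc (0 : ℝ) 1, ∀ t ∈ Icc (0 : ℝ) T, U x t = G (x - t) := by
  have hT1 : 0 < 1 + T := by linarith
  -- The profile is read off on the diagonal from `(0, T)` to `(1, 0)`, which meets every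
  -- characteristic `x - t = s` of the rectangle in a point depending affinely on `s`.
  have hX : ∀ s ∈ Icc (-T) 1, (s + T) / (1 + T) ∈ Icc (0 : ℝ) 1 := fun s hs =>
    ⟨div_nonneg (by linarith [hs.1]) hT1.le, (div_le_one hT1).2 (by linarith [hs.2])⟩
  have hY : ∀ s ∈ Icc (-T) 1, T * (1 - s) / (1 + T) ∈ Icc (0 : ℝ) T := fun s hs =>
    ⟨div_nonneg (mul_nonneg hT.le (by linarith [hs.2])) hT1.le, (div_le_iff₀ hT1).2
      (mul_le_mul_of_nonneg_left (by linarith [hs.1]) hT.le)⟩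
  have hsm : ContDiffOn ℝ 4
      (fun s => Function.uncurry U ((s + T) / (1 + T), T * (1 - s) / (1 + T))) (Icc (-T) 1) := by
    refine (hU.smooth.of_le hm).comp (t := Icc (0 : ℝ) 1 ×ˢ Icc (0 : ℝ) T)
      (f := fun s : ℝ => ((s + T) / (1 + T), T * (1 - s) / (1 + T))) ?_
      (fun s hs => ⟨hX s hs, hY s hs⟩)
    exact ContDiff.contDiffOn (by fun_prop)
  obtain ⟨G, hG, hGe⟩ := ContDiffOn.exists_contDiff_extension (k := 4)
    (by linarith : -T < 1) (by exact_mod_cast hsm)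
  refine ⟨G, by exact_mod_cast hG, fun x hx t ht => ?_⟩
  have hmem : x - t ∈ Icc (-T) 1 := ⟨by linarith [hx.1, ht.2], by linarith [hx.2, ht.1]⟩
  rw [hGe hmem]
  refine hU.eq_of_sub_eq (le_trans (by norm_num) hm) hT hx ht (hX _ hmem) (hY _ hmem) ?_
  field_simp
  ring

/-! ### Existence of semidiscrete solutions and a test solution -/

/-- Existence for inhomogeneous linear systems, by variation of constants. -/
lemma exists_hasDerivAt_linear {E : Type*} [NormedAddCommGroup E] [NormedSpace ℝ E]
    [CompleteSpace E] (A : E →L[ℝ] E) (b : ℝ → E) (hb : Continuous b) (u₀ : E) :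
    ∃ u : ℝ → E, u 0 = u₀ ∧ ∀ t, HasDerivAt u (A (u t) + b t) t := by
  set X : ℝ → E →L[ℝ] E := fun t => NormedSpace.exp (t • A) with hX
  have hXd : ∀ t, HasDerivAt X (A * X t) t := fun t => hasDerivAt_exp_smul_const' A t
  have hXc : Continuous X := continuous_iff_continuousAt.2 fun t => (hXd t).continuousAt
  have hXinv : ∀ t, X t * X (-t) = 1 := fun t => by
    have hc : Commute (t • A) ((-t) • A) := ((Commute.refl A).smul_left t).smul_right (-t)
    have hr : ∀ B : E →L[ℝ] E, B ∈ Metric.eball (0 : E →L[ℝ] E)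
        (NormedSpace.expSeries ℝ (E →L[ℝ] E)).radius := fun B => by
      rw [NormedSpace.expSeries_radius_eq_top]; exact edist_lt_top _ _
    rw [hX, ← NormedSpace.exp_add_of_commute_of_mem_ball hc (hr _) (hr _), ← add_smul]
    simp
  set w : ℝ → E := fun t => u₀ + ∫ s in (0 : ℝ)..t, X (-s) (b s) with hw
  have hcont : Continuous fun s => X (-s) (b s) := (hXc.comp continuous_neg).clm_apply hb
  have hwd : ∀ t, HasDerivAt w (X (-t) (b t)) t := fun t =>
    (intervalIntegral.integral_hasDerivAt_right (hcont.intervalIntegrable _ _)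
      (hcont.stronglyMeasurableAtFilter _ _) hcont.continuousAt).const_add _
  refine ⟨fun t => X t (w t), by simp [hX, hw], fun t => ?_⟩
  refine ((hXd t).clm_apply (hwd t)).congr_deriv ?_
  have := congrArg (fun B : E →L[ℝ] E => B (b t)) (hXinv t)
  simp only [mul_apply_eq_comp, one_apply_eq_self] at this
  rw [mul_apply_eq_comp, this]

/-- `ConvergesWithOrder` quantifies over given families of solutions, so it could hold vacuously
without existence. The lower bounds therefore need an actual family. -/
lemma exists_isSemidiscreteSolution (n : ℕ) (τ T : ℝ) (f : ℝ → ℝ) {g : ℝ → ℝ}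
    (hg : Continuous g) : ∃ u, IsSemidiscreteSolution n τ T f g u := by
  set r := (sbpNorm n)⁻¹.mulVec (firstUnit n)
  set A : (Fin n → ℝ) →L[ℝ] (Fin n → ℝ) := LinearMap.toContinuousLinearMap
    (-(upwindDm n).mulVecLin
      + τ • ((dotProductBilin ℝ ℝ (firstUnit n) : (Fin n → ℝ) →ₗ[ℝ] ℝ).smulRight r)) with hA
  obtain ⟨u, h0, hu⟩ := exists_hasDerivAt_linear A (fun t => -(τ * g t) • r)
    ((continuous_const.mul hg).neg.smul continuous_const) fun j => f (gridPoint n j)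
  refine ⟨u, fun j => by rw [h0], fun t _ => (hu t).hasDerivWithinAt.congr_deriv ?_⟩
  simp only [hA, LinearMap.coe_toContinuousLinearMap', LinearMap.add_apply, LinearMap.neg_apply,
    LinearMap.smul_apply, LinearMap.smulRight_apply, Matrix.mulVecLin_apply,
    dotProductBilin_apply_apply]
  module

lemma isAdvectionSolution_sq (m : WithTop ℕ∞) {T : ℝ} (hT : 0 < T) :
    IsAdvectionSolution m T fun x t => (x - t) ^ 2 := by
  refine ⟨ContDiff.contDiffOn (by unfold Function.uncurry; fun_prop), fun x hx t ht => ?_⟩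
  have h1 : HasDerivAt (fun s : ℝ => (x - s) ^ 2) (-(2 * (x - t))) t := by
    refine (((hasDerivAt_id t).const_sub x).pow 2).congr_deriv ?_
    simp
  have h2 : HasDerivAt (fun y : ℝ => (y - t) ^ 2) (2 * (x - t)) x := by
    refine (((hasDerivAt_id x).sub_const t).pow 2).congr_deriv ?_
    simp
  rw [h1.hasDerivWithinAt.derivWithin (uniqueDiffOn_Icc hT t ht),
    h2.hasDerivWithinAt.derivWithin (uniqueDiffOn_Icc zero_lt_one x hx)]
  ring

/-! ### From squared-error bounds to the convergence rate -/

section Rate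
variable {N : ℕ} {τ T : ℝ} {U : ℝ → ℝ → ℝ} {G : ℝ → ℝ}

/-- The pointwise error for the travelling wave `G (x - t)`, as a sequence. -/
def waveError (N : ℕ) (G : ℝ → ℝ) (u : ℝ → Fin (N + 4) → ℝ) (t : ℝ) (i : ℕ) : ℝ :=
  G (i * gridSpacing (N + 4) - t) - extendZero (u t) i

lemma spaceTimeError_eq_sqrt (hT : 0 < T)
    (hG : ∀ x ∈ Icc (0 : ℝ) 1, ∀ t ∈ Icc (0 : ℝ) T, U x t = G (x - t))
    (u : ℝ → Fin (N + 4) → ℝ) :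
    spaceTimeError (N + 4) T U u = Real.sqrt (∫ t in (0 : ℝ)..T,
      gridSpacing (N + 4) * ∑ i ∈ Finset.range (N + 4), waveError N G u t i ^ 2) := by
  unfold spaceTimeError
  congr 1
  refine intervalIntegral.integral_congr fun t ht => ?_
  rw [uIcc_of_le hT.le] at ht
  rw [← Fin.sum_univ_eq_sum_range (fun i => waveError N G u t i ^ 2)]
  congr 1
  refine Finset.sum_congr rfl fun j _ => ?_
  rw [waveError, extendZero_val, gridPoint, hG _ (gridPoint_mem_Icc j.2) t ht]

lemma waveError_solvesForced {G₁ : ℝ → ℝ} (hT : 0 < T)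
    (hG : ∀ x ∈ Icc (0 : ℝ) 1, ∀ t ∈ Icc (0 : ℝ) T, U x t = G (x - t))
    (h1 : ∀ z, HasDerivAt G (G₁ z) z) {u : ℝ → Fin (N + 4) → ℝ}
    (hu : IsSemidiscreteSolution (N + 4) τ T (fun x => U x 0) (fun t => U 0 t) u) :
    SolvesForced N τ T (waveError N G u) (truncationError N G G₁)
      ∧ ∀ i < N + 4, waveError N G u 0 i = 0 := by
  constructor
  · refine hu.solvesForced (p := fun t i => G (i * gridSpacing (N + 4) - t))
      (q := fun t i => G₁ (i * gridSpacing (N + 4) - t)) (fun t ht => ?_) (fun i _ t _ => ?_)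
    · rw [hG 0 ⟨le_rfl, zero_le_one⟩ t ht]; simp
    · have := (h1 (i * gridSpacing (N + 4) - t)).comp t
        ((hasDerivAt_id t).const_sub (i * gridSpacing (N + 4)))
      simpa [Function.comp_def] using this.hasDerivWithinAt (s := Icc 0 T)
  · intro i hi
    have h0 := hu.initial ⟨i, hi⟩
    rw [waveError, extendZero, dif_pos hi, h0, gridPoint,
      hG _ (gridPoint_mem_Icc hi) 0 ⟨le_rfl, hT.le⟩, sub_self]

lemma sqrt_pow_eq_rpow {x : ℝ} (hx : 0 ≤ x) (k : ℕ) : Real.sqrt (x ^ k) = x ^ ((k : ℝ) / 2) := by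
  rw [Real.sqrt_eq_rpow, ← Real.rpow_natCast, ← Real.rpow_mul hx]
  congr 1
  ring

/-- The four derivatives of the profile are passed as functions on the whole line, so the estimates
never involve derivatives within the rectangle. -/
lemma convergesWithOrder_of_integral_le {m : WithTop ℕ∞} (hm : 4 ≤ m) (hT : 0 < T) (k : ℕ)
    (H : ∀ G G₁ G₂ G₃ G₄ : ℝ → ℝ, (∀ z, HasDerivAt G (G₁ z) z) → (∀ z, HasDerivAt G₁ (G₂ z) z) →
      (∀ z, HasDerivAt G₂ (G₃ z) z) → (∀ z, HasDerivAt G₃ (G₄ z) z) → Continuous G₄ →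
      ∃ C, 0 ≤ C ∧ ∀ (N : ℕ) (e : ℝ → ℕ → ℝ), SolvesForced N τ T e (truncationError N G G₁) →
        (∀ i < N + 4, e 0 i = 0) →
        ∫ t in (0 : ℝ)..T, gridSpacing (N + 4) * ∑ i ∈ Finset.range (N + 4), e t i ^ 2
          ≤ C * gridSpacing (N + 4) ^ k) :
    ConvergesWithOrder m T τ ((k : ℝ) / 2) := by
  intro U hU u hu
  obtain ⟨G, hGs, hG⟩ := hU.exists_profile hm hT
  have succ : ∀ {n : ℕ} {f : ℝ → ℝ}, ContDiff ℝ (n + 1) f →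
      (∀ z, HasDerivAt f (deriv f z) z) ∧ ContDiff ℝ n (deriv f) := fun {n f} hf => by
    rw [contDiff_succ_iff_deriv] at hf
    exact ⟨fun z => (hf.1 z).hasDerivAt, hf.2.2⟩
  have s1 := succ (n := 3) (f := G) (by norm_num; exact hGs)
  have s2 := succ (n := 2) (by exact_mod_cast s1.2)
  have s3 := succ (n := 1) (by exact_mod_cast s2.2)
  have s4 := succ (n := 0) (by exact_mod_cast s3.2)
  obtain ⟨C, hC, hCb⟩ := H _ _ _ _ _ s1.1 s2.1 s3.1 s4.1 s4.2.continuous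
  refine IsBigO.of_bound (Real.sqrt C) ?_
  filter_upwards [eventually_ge_atTop 4] with n hn
  obtain ⟨N, rfl⟩ := Nat.exists_eq_add_of_le' hn
  have hh := gridSpacing_add_four_pos N
  obtain ⟨he, he0⟩ := waveError_solvesForced hT hG s1.1 (hu (N + 4) hn)
  rw [spaceTimeError_eq_sqrt hT hG, Real.norm_of_nonneg (Real.sqrt_nonneg _),
    Real.norm_of_nonneg (Real.rpow_nonneg hh.le _), ← sqrt_pow_eq_rpow hh.le,
    ← Real.sqrt_mul hC]
  exact Real.sqrt_le_sqrt (hCb N _ he he0)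

lemma tendsto_gridSpacing : Tendsto gridSpacing atTop (𝓝 0) := by
  have : Tendsto (fun n : ℕ => (n : ℝ) - 1) atTop atTop :=
    tendsto_atTop_add_const_right _ _ tendsto_natCast_atTop_atTop
  exact (tendsto_inv_atTop_zero.comp this).congr fun n => by simp [gridSpacing]

/-- If `r` exceeded `k/2`, then `√c ≤ D h^(r - k/2)` for all large `n`, although the right side
tends to `0`. -/
lemma le_of_convergesWithOrder {m : WithTop ℕ∞} (hT : 0 < T) {k : ℕ} {c r : ℝ} (hc : 0 < c)
    (H : ∀ᶠ n in atTop, ∀ N, n = N + 4 → ∀ e : ℝ → ℕ → ℝ,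
      SolvesForced N τ T e (truncationError N (fun s => s ^ 2) fun s => 2 * s) →
      (∀ i < N + 4, e 0 i = 0) → c * gridSpacing (N + 4) ^ k
        ≤ ∫ t in (0 : ℝ)..T, gridSpacing (N + 4) * ∑ i ∈ Finset.range (N + 4), e t i ^ 2)
    (hr : ConvergesWithOrder m T τ r) : r ≤ (k : ℝ) / 2 := by
  by_contra! hlt
  choose u hu using fun n : ℕ => exists_isSemidiscreteSolution n τ T
    (fun x => (x - 0) ^ 2) (g := fun t => (0 - t) ^ 2) (by fun_prop)
  have hO := hr _ (isAdvectionSolution_sq m hT) u fun n _ => hu n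
  obtain ⟨D, hD⟩ := hO.bound
  have hlim : Tendsto (fun n => D * gridSpacing n ^ (r - (k : ℝ) / 2)) atTop (𝓝 0) := by
    have := (tendsto_gridSpacing.rpow_const (p := r - (k : ℝ) / 2)
      (Or.inr (by linarith))).const_mul D
    rwa [Real.zero_rpow (by linarith), mul_zero] at this
  obtain ⟨n, h1, h2, h3, h4⟩ := (hD.and (H.and ((hlim.eventually_lt_const
    (Real.sqrt_pos.2 hc)).and (eventually_ge_atTop 4)))).exists
  obtain ⟨N, rfl⟩ := Nat.exists_eq_add_of_le' h4
  have hh := gridSpacing_add_four_pos N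
  have hsq : ∀ z : ℝ, HasDerivAt (fun s : ℝ => s ^ 2) (2 * z) z := fun z => by
    simpa using hasDerivAt_pow 2 z
  have hG : ∀ x ∈ Icc (0 : ℝ) 1, ∀ t ∈ Icc (0 : ℝ) T,
      (fun x t : ℝ => (x - t) ^ 2) x t = (fun s : ℝ => s ^ 2) (x - t) := fun _ _ _ _ => rfl
  obtain ⟨he, he0⟩ := waveError_solvesForced (G := fun s => s ^ 2) hT hG hsq (hu (N + 4))
  rw [spaceTimeError_eq_sqrt (G := fun s => s ^ 2) hT hG, Real.norm_of_nonneg (Real.sqrt_nonneg _),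
    Real.norm_of_nonneg (Real.rpow_nonneg hh.le _)] at h1
  have h5 := (Real.sqrt_le_sqrt (h2 N rfl _ he he0)).trans h1
  rw [Real.sqrt_mul hc.le, sqrt_pow_eq_rpow hh.le] at h5
  have hpos : 0 < gridSpacing (N + 4) ^ ((k : ℝ) / 2) := Real.rpow_pos_of_pos hh _
  have h6 : gridSpacing (N + 4) ^ r
      = gridSpacing (N + 4) ^ (r - (k : ℝ) / 2) * gridSpacing (N + 4) ^ ((k : ℝ) / 2) := by
    rw [← Real.rpow_add hh]; congr 1; ring
  rw [h6, ← mul_assoc] at h5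
  exact absurd (le_of_mul_le_mul_right h5 hpos) (not_le.2 h3)

/-- Both upper rates at once: `h⁵` comes from the decaying parts and the remainders, `h⁴` from the
constant part of the inflow layer. -/
lemma integral_error_sq_le (hT : 0 < T) (hτ : τ ≤ -1 / 2) {G G₁ G₂ G₃ G₄ : ℝ → ℝ}
    (h1 : ∀ z, HasDerivAt G (G₁ z) z) (h2 : ∀ z, HasDerivAt G₁ (G₂ z) z)
    (h3 : ∀ z, HasDerivAt G₂ (G₃ z) z) (h4 : ∀ z, HasDerivAt G₃ (G₄ z) z) (hc : Continuous G₄) :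
    ∃ C, 0 ≤ C ∧ ∀ (N : ℕ) (e : ℝ → ℕ → ℝ), SolvesForced N τ T e (truncationError N G G₁) →
      (∀ i < N + 4, e 0 i = 0) →
      ∫ t in (0 : ℝ)..T, gridSpacing (N + 4) * ∑ i ∈ Finset.range (N + 4), e t i ^ 2
        ≤ C * (5 * gridSpacing (N + 4) ^ 5 + 4 * (1 + 1 / τ) ^ 2 * gridSpacing (N + 4) ^ 4) := by
  obtain ⟨M, hM, hG⟩ := exists_hasTaylorBounds (-T) 1 h1 h2 h3 h4 hc
  set K := 10 + 10 * |τ| with hK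
  set C := 6 * Real.exp T * (8 * M ^ 2 + (8 * (13 * M + 4 * M * K) ^ 2 + 48 * M ^ 2)) + 8 * M ^ 2
    with hC
  have hC0 : 0 ≤ C := by positivity
  refine ⟨T * C, by positivity, fun N e he he0 => ?_⟩
  have hh := gridSpacing_add_four_pos N
  set h := gridSpacing (N + 4) with hdef
  set S := 4 + 4 * (1 + 1 / τ) ^ 2 / h with hS
  have hS3 : 3 ≤ S := by
    have : 0 ≤ 4 * (1 + 1 / τ) ^ 2 / h := by positivity
    linarith
  have hφ := isBoundaryLayer_inflowLayer N hτ (K := K) (S := S)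
    (by linarith [abs_nonneg τ]) le_rfl
  have hψ := isBoundaryLayer_outflowLayer N τ (K := K) (S := S) le_rfl hS3
  have hb : ∀ t ∈ uIoc (0 : ℝ) T, ‖h * ∑ i ∈ Finset.range (N + 4), e t i ^ 2‖
      ≤ h * (C * (h ^ 4 * (1 + S))) := by
    intro t ht
    rw [uIoc_of_le hT.le] at ht
    rw [Real.norm_of_nonneg (mul_nonneg hh.le (Finset.sum_nonneg fun _ _ => sq_nonneg _))]
    exact mul_le_mul_of_nonneg_left
      (sum_error_sq_le hτ hM hG h3 hφ hψ he he0 (Ioc_subset_Icc_self ht)) hh.le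
  have := intervalIntegral.norm_integral_le_of_norm_le_const hb
  rw [sub_zero, abs_of_pos hT] at this
  refine (le_abs_self _).trans (this.trans_eq ?_)
  rw [hS]
  field_simp
  ring

end Rate

end

theorem theorem2 (m : WithTop ℕ∞) (hm : 4 ≤ m) (T : ℝ) (hT : 0 < T) (τ : ℝ)
    (hτ : τ ≤ -1 / 2) :
    (τ = -1 → IsConvergenceRate m T τ (5 / 2)) ∧ (τ ≠ -1 → IsConvergenceRate m T τ 2) := by
  refine ⟨fun hτ1 => ⟨?_, fun r hr => ?_⟩, fun hτ1 => ⟨?_, fun r hr => ?_⟩⟩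
  · have := convergesWithOrder_of_integral_le (τ := τ) hm hT 5 fun G G₁ G₂ G₃ G₄ h1 h2 h3 h4 hc => by
      obtain ⟨C, hC, H⟩ := integral_error_sq_le hT hτ h1 h2 h3 h4 hc
      refine ⟨C * 5, by positivity, fun N e he he0 => (H N e he he0).trans_eq ?_⟩
      -- For `τ = -1` the factor `(1 + 1/τ)²` of the `h⁴` term is zero.
      rw [hτ1]; ring
    exact_mod_cast this
  · have hpos : 0 < T ^ 3 / (16 * (1 + T * (2 + 3 * |τ|)) ^ 2) := by positivity
    have := le_of_convergesWithOrder hT hpos (k := 5)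
      (Eventually.of_forall fun _ N _ e he he0 => pow_five_le_integral hT he he0) hr
    exact_mod_cast this
  · have := convergesWithOrder_of_integral_le (τ := τ) hm hT 4 fun G G₁ G₂ G₃ G₄ h1 h2 h3 h4 hc => by
      obtain ⟨C, hC, H⟩ := integral_error_sq_le hT hτ h1 h2 h3 h4 hc
      refine ⟨C * (5 + 4 * (1 + 1 / τ) ^ 2), by positivity, fun N e he he0 =>
        (H N e he he0).trans ?_⟩
      rw [mul_assoc C]
      refine mul_le_mul_of_nonneg_left ?_ hC
      have : gridSpacing (N + 4) ^ 5 ≤ gridSpacing (N + 4) ^ 4 :=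
        pow_le_pow_of_le_one (gridSpacing_add_four_pos N).le (gridSpacing_add_four_le_one N)
          (by norm_num)
      linarith
    norm_num at this
    exact this
  · have hδ : 0 < |1 + 1 / τ| := by
      rw [abs_pos]
      intro h0
      have hτ0 : τ ≠ 0 := by linarith
      field_simp at h0
      exact hτ1 (by linarith)
    have hpos : 0 < |1 + 1 / τ| ^ 2 * T ^ 3 / (288 * (3 + 8 * T) ^ 2) := by positivity
    have hev : ∀ᶠ n in atTop, 24 * gridSpacing n < |1 + 1 / τ| := by
      have := tendsto_gridSpacing.const_mul 24
      rw [mul_zero] at this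
      exact this.eventually_lt_const hδ
    have := le_of_convergesWithOrder hT hpos (k := 4) (hev.mono fun n hn N hN e he he0 =>
      pow_four_le_integral hT hτ hτ1 (by rw [← hN]; exact hn.le) he he0) hr
    norm_num at this
    exact this
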